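/- Throughout, $\mathbb{N}=\{1,2,\dots\}$ and $\mathbb{N}_0=\mathbb{N}\cup\{0\}$. For $E\subset\mathbb{N}_0$ put $$\underline{d}(E)=\liminf_{n\to\infty}\frac{\#(E\cap[0,n])}{n},\qquad \overline{d}(E)=\limsup_{n\to\infty}\frac{\#(E\cap[0,n])}{n},\qquad \overline{b}(E)=\lim_{s\to\infty}\Big[\limsup_{k\to\infty}\frac{\#(E\cap[k+1,k+s])}{s}\Big].$$ Let $\Gamma\subset\mathbb{C}$. A bounded linear operator $T$ on a complex Banach space $X$ is called frequently (respectively $\mathscr{U}$-frequently, reiteratively) $\Gamma$-supercyclic if there is $x\in X$ such that for every non-empty open set $U\subset X$ the set $$\{n\in\mathbb{N}_0 : T^n(\gamma x)\in U\text{ for some }\gamma\in\Gamma\}$$ has positive lower density $\underline{d}$ (respectively positive upper density $\overline{d}$, positive upper Banach density $\overline{b}$). Let $\Gamma\subset\mathbb{C}$ be such that $\Gamma\setminus\{0\}$ is non-empty, bounded and bounded away from zero, and let $1\le p<\infty$. Unilateral case. Let ${\bf w}=(w_n)_{n\ge1}$ be a bounded sequence of positive real numbers and let $B_{\bf w}$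 be the unilateral weighted backward shift on the complex space $\ell_p(\mathbb{N})$ given by $(B_{\bf w}x)_n=w_n x_{n+1}$ for $n\geq 1$. Then the following are equivalent: (A) $B_{\bf w}$ is frequently $\Gamma$-supercyclic; (B) $B_{\bf w}$ is $\mathscr{U}$-frequently $\Gamma$-supercyclic; (C) $B_{\bf w}$ is reiteratively $\Gamma$-supercyclic; (D) $\displaystyle\sum_{n\ge1}\Big(\frac{1}{w_1\cdots w_n}\Big)^p<\infty$. Bilateral case. Let ${\bf w}=(w_n)_{n\in\mathbb{Z}}$ be a bounded family of positive real numbers and let $B_{\bf w}$ be the bilateral weighted backward shift on the complex space $\ell_p(\mathbb{Z})$ given by $(B_{\bf w}x)_n=w_n x_{n+1}$ for $n\in\mathbb{Z}$. Then (A), (B) and (C) are equivalent to each other and to (D$'$) $\displaystyle\sum_{n\ge1}\Big(\frac{1}{w_1\cdots w_n}\Big)^p<\infty$ and $\displaystyle\sum_{n<0}\big(w_{-1}w_{-2}\cdots w_n\big)^p<\infty$. -/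

import Mathlib

open Filter Topology
open scoped ENNReal

noncomputable section

/-! ### Densities of sets of non-negative integers -/

/-- Lower asymptotic density: `liminf #(E ∩ [0,n]) / n`. -/
def lowerDensity (E : Set ℕ) : ℝ :=
  liminf (fun n : ℕ => ((E ∩ Set.Icc 0 n).ncard : ℝ) / (n : ℝ)) atTop

/-- Upper asymptotic density: `limsup #(E ∩ [0,n]) / n`. -/
def upperDensity (E : Set ℕ) : ℝ :=
  limsup (fun n : ℕ => ((E ∩ Set.Icc 0 n).ncard : ℝ) / (n : ℝ)) atTop

/-- The largest frequency with which windows of length `s` that are far out meet `E`: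
`limsup_k #(E ∩ [k+1,k+s]) / s`. -/
def windowDensity (E : Set ℕ) (s : ℕ) : ℝ :=
  limsup (fun k : ℕ => ((E ∩ Set.Icc (k + 1) (k + s)).ncard : ℝ) / (s : ℝ)) atTop

/-- Upper Banach density: `lim_s limsup_k #(E ∩ [k+1,k+s]) / s`. The limit always exists,
see `tendsto_upperBanachDensity`. -/
def upperBanachDensity (E : Set ℕ) : ℝ :=
  limUnder atTop (windowDensity E)

theorem ncard_window_le (E : Set ℕ) (k s : ℕ) :
    (E ∩ Set.Icc (k + 1) (k + s)).ncard ≤ s := by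
  calc (E ∩ Set.Icc (k + 1) (k + s)).ncard
      ≤ (Set.Icc (k + 1) (k + s)).ncard :=
        Set.ncard_le_ncard Set.inter_subset_right (Set.finite_Icc _ _)
    _ = s := by
        rw [← Finset.coe_Icc, Set.ncard_coe_finset, Nat.card_Icc]; omega

theorem ncard_window_add_le (E : Set ℕ) (k s t : ℕ) :
    (E ∩ Set.Icc (k + 1) (k + (s + t))).ncard ≤
      (E ∩ Set.Icc (k + 1) (k + s)).ncard
        + (E ∩ Set.Icc (k + s + 1) (k + s + t)).ncard := by
  refine le_trans (Set.ncard_le_ncard ?_ ?_) (Set.ncard_union_le _ _)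
  · rintro x ⟨hx, h1, h2⟩
    by_cases h : x ≤ k + s
    · exact Or.inl ⟨hx, h1, h⟩
    · exact Or.inr ⟨hx, by omega, by omega⟩
  · exact ((Set.finite_Icc _ _).inter_of_right _).union ((Set.finite_Icc _ _).inter_of_right _)

/-- The limit that defines the upper Banach density exists. -/
theorem tendsto_upperBanachDensity (E : Set ℕ) :
    Tendsto (windowDensity E) atTop (𝓝 (upperBanachDensity E)) := by
  let c : ℕ → ℕ → ℝ := fun s k => ((E ∩ Set.Icc (k + 1) (k + s)).ncard : ℝ)
  have hc0 : ∀ s k, 0 ≤ c s k := fun s k => Nat.cast_nonneg _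
  have hcs : ∀ s k, c s k ≤ s := fun s k =>
    Nat.cast_le.2 (ncard_window_le E k s)
  have hb : ∀ s, IsBoundedUnder (· ≤ ·) atTop (c s) := fun s =>
    isBoundedUnder_of ⟨s, hcs s⟩
  have hcb : ∀ s, IsBoundedUnder (· ≥ ·) atTop (c s) := fun s =>
    isBoundedUnder_of ⟨0, hc0 s⟩
  have hsub : Subadditive (fun s => limsup (c s) atTop) := by
    intro s t
    have hshift : limsup (fun k => c t (k + s)) atTop = limsup (c t) atTop :=
      Filter.limsup_nat_add (c t) s
    have hb' : IsBoundedUnder (· ≤ ·) atTop (fun k => c t (k + s)) :=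
      isBoundedUnder_of ⟨t, fun k => hcs t _⟩
    have hcb' : IsBoundedUnder (· ≥ ·) atTop (fun k => c t (k + s)) :=
      isBoundedUnder_of ⟨0, fun k => hc0 t _⟩
    calc limsup (c (s + t)) atTop
        ≤ limsup (c s + fun k => c t (k + s)) atTop := by
          refine limsup_le_limsup (Eventually.of_forall fun k => ?_)
            (hcb _).isCoboundedUnder_le (isBoundedUnder_le_add (hb s) hb')
          have := ncard_window_add_le E k s t
          simp only [c, Pi.add_apply]
          exact_mod_cast this
      _ ≤ limsup (c s) atTop + limsup (fun k => c t (k + s)) atTop :=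
          limsup_add_le (hcb s) (hb s) hcb'.isCoboundedUnder_le hb'
      _ = _ := by rw [hshift]
  have hnn : ∀ s, 0 ≤ limsup (c s) atTop := fun s =>
    le_limsup_of_frequently_le (Frequently.of_forall (hc0 s)) (hb s)
  have hlim := hsub.tendsto_lim ⟨0, by
    rintro _ ⟨n, rfl⟩
    exact div_nonneg (hnn n) (Nat.cast_nonneg n)⟩
  have heq : windowDensity E = fun s : ℕ => limsup (c s) atTop / (s : ℝ) := by
    funext s
    have hm : Monotone fun x : ℝ => x / (s : ℝ) := fun a b h =>
      div_le_div_of_nonneg_right h (Nat.cast_nonneg s)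
    exact (hm.map_limsup_of_continuousAt (c s) (by fun_prop) (hb s)
      (hcb s).isCoboundedUnder_le).symm
  rw [← heq] at hlim
  exact tendsto_nhds_limUnder ⟨_, hlim⟩

/-! ### Furstenberg families and `Γ`-supercyclicity -/

/-- The sets of positive lower asymptotic density. -/
def posLowerDensity : Set (Set ℕ) := {E | 0 < lowerDensity E}

/-- The sets of positive upper asymptotic density. -/
def posUpperDensity : Set (Set ℕ) := {E | 0 < upperDensity E}

/-- The sets of positive upper Banach density. -/
def posUpperBanachDensity : Set (Set ℕ) := {E | 0 < upperBanachDensity E}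

section Dynamics

variable {X : Type*} [NormedAddCommGroup X] [NormedSpace ℂ X]

/-- The return set `{n : T^n (Γ x) ∩ U ≠ ∅}`. -/
def returnSet (T : X →L[ℂ] X) (Γ : Set ℂ) (x : X) (U : Set X) : Set ℕ :=
  {n | ∃ γ ∈ Γ, (T ^ n) (γ • x) ∈ U}

/-- `T` is `F_Γ`-hypercyclic: some vector `x` has all its return sets to non-empty open sets
in the family `F`. -/
def IsFamilyHypercyclic (F : Set (Set ℕ)) (Γ : Set ℂ) (T : X →L[ℂ] X) : Prop :=
  ∃ x : X, ∀ U : Set X, IsOpen U → U.Nonempty → returnSet T Γ x U ∈ F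

/-- Frequent `Γ`-supercyclicity. -/
def IsFrequentlySupercyclic (Γ : Set ℂ) (T : X →L[ℂ] X) : Prop :=
  IsFamilyHypercyclic posLowerDensity Γ T

/-- `𝒰`-frequent `Γ`-supercyclicity. -/
def IsUFrequentlySupercyclic (Γ : Set ℂ) (T : X →L[ℂ] X) : Prop :=
  IsFamilyHypercyclic posUpperDensity Γ T

/-- Reiterative `Γ`-supercyclicity. -/
def IsReiterativelySupercyclic (Γ : Set ℂ) (T : X →L[ℂ] X) : Prop :=
  IsFamilyHypercyclic posUpperBanachDensity Γ T

end Dynamics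

/-! ### Weighted backward shifts -/

section Shift

variable {ι : Type*} [Add ι] [One ι] [IsRightCancelAdd ι]

theorem summable_shift_norm_rpow (p : ℝ≥0∞) [hp1 : Fact (1 ≤ p)] (hp : p ≠ ∞)
    (x : lp (fun _ : ι => ℂ) p) :
    Summable (fun i : ι => ‖x (i + 1)‖ ^ p.toReal) ∧
      ∑' i : ι, ‖x (i + 1)‖ ^ p.toReal ≤ ‖x‖ ^ p.toReal := by
  have hp0 : 0 < p.toReal := ENNReal.toReal_pos (zero_lt_one.trans_le hp1.out).ne' hp
  have hinj : Function.Injective (fun i : ι => i + 1) := add_left_injective 1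
  have hs : Summable (fun i : ι => ‖x i‖ ^ p.toReal) := (memℓp_gen_iff hp0).1 (lp.memℓp x)
  refine ⟨hs.comp_injective hinj, ?_⟩
  rw [lp.norm_rpow_eq_tsum hp0]
  exact tsum_comp_le_tsum_of_inj hs (fun i => by positivity) hinj

theorem weighted_norm_rpow_le {κ : Type*} [Add κ] [One κ] {w : κ → ℝ} {C : ℝ} (hC : ∀ i, ‖w i‖ ≤ C) {r : ℝ} (hr : 0 ≤ r)
    (x : κ → ℂ) (i : κ) :
    ‖(w i : ℂ) * x (i + 1)‖ ^ r ≤ C ^ r * ‖x (i + 1)‖ ^ r := by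
  have hC0 : 0 ≤ C := (norm_nonneg _).trans (hC i)
  rw [← Real.mul_rpow hC0 (norm_nonneg _), norm_mul, Complex.norm_real]
  exact Real.rpow_le_rpow (by positivity)
    (mul_le_mul_of_nonneg_right (hC i) (norm_nonneg _)) hr

theorem memℓp_weighted_shift (p : ℝ≥0∞) [hp1 : Fact (1 ≤ p)] (hp : p ≠ ∞) {w : ι → ℝ}
    (hw : Bornology.IsBounded (Set.range w)) (x : lp (fun _ : ι => ℂ) p) :
    Memℓp (fun i : ι => (w i : ℂ) * x (i + 1)) p := by
  obtain ⟨C, hC⟩ := hw.exists_norm_le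
  have hC' : ∀ i, ‖w i‖ ≤ C := fun i => hC _ ⟨i, rfl⟩
  have hp0 : 0 < p.toReal := ENNReal.toReal_pos (zero_lt_one.trans_le hp1.out).ne' hp
  refine memℓp_gen (Summable.of_nonneg_of_le (fun i => by positivity)
    (fun i => weighted_norm_rpow_le hC' hp0.le x i)
    ((summable_shift_norm_rpow p hp x).1.mul_left _))

/-- The weighted backward shift `(B_w x)_i = w_i x_{i+1}`, that is, `B_w e_{i+1} = w_i e_i`, on
`ℓ_p(ι)`, `1 ≤ p < ∞`, for a bounded sequence of weights `w`. It is unilateral for `ι = ℕ+`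
(where `e_1`, not being of the form `e_{i+1}`, is sent to `0`) and bilateral for `ι = ℤ`. -/
def weightedBackwardShift (p : ℝ≥0∞) [hp1 : Fact (1 ≤ p)] (hp : p ≠ ∞) (w : ι → ℝ)
    (hw : Bornology.IsBounded (Set.range w)) :
    lp (fun _ : ι => ℂ) p →L[ℂ] lp (fun _ : ι => ℂ) p :=
  LinearMap.mkContinuousOfExistsBound
    { toFun := fun x => ⟨fun i => (w i : ℂ) * x (i + 1), memℓp_weighted_shift p hp hw x⟩
      map_add' := fun x y => by
        ext i
        exact mul_add _ _ _
      map_smul' := fun c x => by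
        ext i
        exact mul_left_comm _ _ _ }
    (by
      obtain ⟨C, hC⟩ := hw.exists_norm_le
      have hC' : ∀ i, ‖w i‖ ≤ max C 0 := fun i => (hC _ ⟨i, rfl⟩).trans (le_max_left _ _)
      have hp0 : 0 < p.toReal := ENNReal.toReal_pos (zero_lt_one.trans_le hp1.out).ne' hp
      refine ⟨max C 0, fun x => lp.norm_le_of_tsum_le hp0 (by positivity) ?_⟩
      obtain ⟨h1, h2⟩ := summable_shift_norm_rpow p hp x
      rw [Real.mul_rpow (le_max_right _ _) (norm_nonneg _)]
      calc ∑' i : ι, ‖(w i : ℂ) * x (i + 1)‖ ^ p.toReal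
          ≤ ∑' i : ι, (max C 0) ^ p.toReal * ‖x (i + 1)‖ ^ p.toReal :=
            ((memℓp_gen_iff hp0).1 (memℓp_weighted_shift p hp hw x)).tsum_le_tsum
              (fun i => weighted_norm_rpow_le hC' hp0.le x i) (h1.mul_left _)
        _ = (max C 0) ^ p.toReal * ∑' i : ι, ‖x (i + 1)‖ ^ p.toReal := tsum_mul_left
        _ ≤ (max C 0) ^ p.toReal * ‖x‖ ^ p.toReal :=
            mul_le_mul_of_nonneg_left h2 (by positivity))

@[simp]
theorem weightedBackwardShift_apply (p : ℝ≥0∞) [Fact (1 ≤ p)] (hp : p ≠ ∞) (w : ι → ℝ)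
    (hw : Bornology.IsBounded (Set.range w)) (x : lp (fun _ : ι => ℂ) p) (i : ι) :
    weightedBackwardShift p hp w hw x i = (w i : ℂ) * x (i + 1) :=
  rfl

end Shift

end

open Filter Topology
open scoped ENNReal

noncomputable section

/-! ### Comparison of densities -/

/-! The implications (A) → (B) → (C) only compare densities. The content lies in (C) → (D) and (D) →
(A), which share no machinery.

For (C) → (D), let `E` be the set of times at which some multiple `γ • x`, `γ ∈ Γ`, is carried close
to a unit vector. As `Γ \ {0}` is bounded and bounded away from zero, at these times the orbit of
`x` itself is bounded in norm and has one coordinate bounded below (`exists_return_bounds`). If `n`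
and `n + d` lie in `E`, that coordinate at time `n + d` is a weight product times the coordinate of
`T ^ n x` lying `d` places to the right. Hence the `ℓ_p` norm at time `n` bounds the sum of `(1 /
(weight product)) ^ p` over all such `d`, uniformly in `n ∈ E`; looking from `n` back to `n - d`
gives the products to the left. A shift-invariant mean `L` with `0 < L E` (`exists_invariant_mean`)
turns this into a bound for the sum of `g d * L (E ∩ (E - d))`. The `d` for which this mean is at
least a fixed `δ` have bounded gaps (`exists_recurrent_difference`), so `g` is summable along a set
with bounded gaps, and then everywhere, because bounded weights let `g` vary at most geometrically
in one direction (`summable_of_sum_differences_le`).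

For (D) → (A), the summability conditions say that every unit vector has a summable forward orbit
and a summable backward orbit. Such vectors form a subspace, here dense, and the frequent
hypercyclicity criterion applies: sum backward orbits sampled along disjoint, well separated sets of
positive lower density (`exists_separated_sets`, `exists_frequently_visiting_vector`). Dividing the
resulting vector by one non-zero `γ ∈ Γ` brings in `Γ`. -/

theorem ncard_inter_Icc_zero_le (E : Set ℕ) (n : ℕ) : (E ∩ Set.Icc 0 n).ncard ≤ n + 1 := by
  calc (E ∩ Set.Icc 0 n).ncard ≤ (Set.Icc 0 n).ncard :=
        Set.ncard_le_ncard Set.inter_subset_right (Set.finite_Icc _ _)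
    _ = n + 1 := by
        rw [← Finset.coe_Icc, Set.ncard_coe_finset, Nat.card_Icc]; omega

theorem density_quotient_nonneg (E : Set ℕ) (n : ℕ) :
    0 ≤ ((E ∩ Set.Icc 0 n).ncard : ℝ) / (n : ℝ) := by positivity

theorem density_quotient_le_two (E : Set ℕ) (n : ℕ) :
    ((E ∩ Set.Icc 0 n).ncard : ℝ) / (n : ℝ) ≤ 2 := by
  rcases Nat.eq_zero_or_pos n with rfl | hn
  · simp
  · rw [div_le_iff₀ (by exact_mod_cast hn)]
    have := ncard_inter_Icc_zero_le E n
    have h2 : (E ∩ Set.Icc 0 n).ncard ≤ 2 * n := by omega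
    exact_mod_cast h2

theorem isBoundedUnder_le_density_quotient (E : Set ℕ) :
    IsBoundedUnder (· ≤ ·) atTop
      (fun n : ℕ => ((E ∩ Set.Icc 0 n).ncard : ℝ) / (n : ℝ)) :=
  isBoundedUnder_of ⟨2, density_quotient_le_two E⟩

theorem isBoundedUnder_ge_density_quotient (E : Set ℕ) :
    IsBoundedUnder (· ≥ ·) atTop
      (fun n : ℕ => ((E ∩ Set.Icc 0 n).ncard : ℝ) / (n : ℝ)) :=
  isBoundedUnder_of ⟨0, density_quotient_nonneg E⟩

theorem lowerDensity_le_upperDensity (E : Set ℕ) : lowerDensity E ≤ upperDensity E :=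
  liminf_le_limsup (isBoundedUnder_le_density_quotient E) (isBoundedUnder_ge_density_quotient E)

theorem lowerDensity_mono {E F : Set ℕ} (h : E ⊆ F) : lowerDensity E ≤ lowerDensity F := by
  refine liminf_le_liminf (Eventually.of_forall fun n => ?_)
    (isBoundedUnder_ge_density_quotient E)
    (isBoundedUnder_le_density_quotient F).isCoboundedUnder_ge
  exact div_le_div_of_nonneg_right (Nat.cast_le.2 (Set.ncard_le_ncard
    (Set.inter_subset_inter_left _ h) ((Set.finite_Icc _ _).inter_of_right _)))
    (Nat.cast_nonneg n)

/-- A set that is enumerated without repetition at a linear rate has positive lower density. -/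
theorem lowerDensity_pos_of_injective {E : Set ℕ} {a : ℕ → ℕ} (ha : Function.Injective a)
    (hE : ∀ q, a q ∈ E) {L : ℕ} (hL : 0 < L) (haL : ∀ q, a q ≤ L * (q + 1)) :
    0 < lowerDensity E := by
  have hLR : (0 : ℝ) < L := by exact_mod_cast hL
  have hcount : ∀ n, n / L ≤ (E ∩ Set.Icc 0 n).ncard := by
    intro n
    calc n / L = (a '' (Finset.range (n / L) : Set ℕ)).ncard := by
          rw [Set.ncard_image_of_injective _ ha, Set.ncard_coe_finset, Finset.card_range]
      _ ≤ _ := by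
          refine Set.ncard_le_ncard ?_ ((Set.finite_Icc _ _).inter_of_right _)
          rintro _ ⟨q, hq, rfl⟩
          refine ⟨hE q, Nat.zero_le _, (haL q).trans ?_⟩
          have hq' : q + 1 ≤ n / L := by simpa using hq
          exact (Nat.mul_le_mul_left L hq').trans (Nat.mul_div_le n L)
  have hev : ∀ᶠ n : ℕ in atTop,
      1 / (2 * (L : ℝ)) ≤ ((E ∩ Set.Icc 0 n).ncard : ℝ) / (n : ℝ) := by
    filter_upwards [eventually_ge_atTop (2 * L)] with n hn
    have hn0 : (0 : ℝ) < n := by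
      have : 0 < n := by omega
      exact_mod_cast this
    rw [div_le_div_iff₀ (by positivity) hn0, one_mul]
    have h1 : n < L * (n / L + 1) := Nat.lt_mul_div_succ n hL
    have h2 : n ≤ (E ∩ Set.Icc 0 n).ncard * (2 * L) := by
      have h3 := Nat.mul_le_mul_left (2 * L) (hcount n)
      have h4 : 2 * L * (n / L) = 2 * (L * (n / L)) := by ring
      rw [mul_add, mul_one] at h1
      rw [mul_comm]
      omega
    exact_mod_cast h2
  exact lt_of_lt_of_le (by positivity : 0 < 1 / (2 * (L : ℝ)))
    (le_liminf_of_le (isBoundedUnder_le_density_quotient E).isCoboundedUnder_ge hev)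

theorem isBoundedUnder_le_window (E : Set ℕ) (s : ℕ) :
    IsBoundedUnder (· ≤ ·) atTop
      (fun k : ℕ => ((E ∩ Set.Icc (k + 1) (k + s)).ncard : ℝ) / (s : ℝ)) :=
  isBoundedUnder_of ⟨1, fun k => div_le_one_of_le₀
    (Nat.cast_le.2 (ncard_window_le E k s)) (Nat.cast_nonneg s)⟩

theorem isCoboundedUnder_le_window (E : Set ℕ) (s : ℕ) :
    IsCoboundedUnder (· ≤ ·) atTop
      (fun k : ℕ => ((E ∩ Set.Icc (k + 1) (k + s)).ncard : ℝ) / (s : ℝ)) :=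
  (isBoundedUnder_of ⟨0, fun k => by positivity⟩ : IsBoundedUnder (· ≥ ·) atTop
    (fun k : ℕ => ((E ∩ Set.Icc (k + 1) (k + s)).ncard : ℝ) / (s : ℝ))).isCoboundedUnder_le

theorem ncard_inter_Icc_zero_add_le (E : Set ℕ) (k t : ℕ) :
    (E ∩ Set.Icc 0 (k + t)).ncard ≤
      (E ∩ Set.Icc 0 k).ncard + (E ∩ Set.Icc (k + 1) (k + t)).ncard := by
  refine le_trans (Set.ncard_le_ncard ?_ ?_) (Set.ncard_union_le _ _)
  · rintro x ⟨hx, h1, h2⟩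
    by_cases h : x ≤ k
    · exact Or.inl ⟨hx, h1, h⟩
    · exact Or.inr ⟨hx, by omega, by omega⟩
  · exact ((Set.finite_Icc _ _).inter_of_right _).union ((Set.finite_Icc _ _).inter_of_right _)

/-- Otherwise all windows of length `s` beyond some `k₀` hold fewer than `δ / 2 * s` points. Tiling
by such windows gives a count of at most a constant plus `δ / 2 * n`; absorbing the constant costs
another `δ / 4`, and the upper density would be at most `3 / 4 * δ`. -/
theorem half_upperDensity_le_windowDensity {E : Set ℕ} (hE : 0 < upperDensity E) {s : ℕ}
    (hs : 0 < s) : upperDensity E / 2 ≤ windowDensity E s := by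
  by_contra! hlt
  set δ := upperDensity E with hδ
  have hsR : (0 : ℝ) < s := by exact_mod_cast hs
  obtain ⟨k₀, hk₀⟩ := eventually_atTop.1
    (eventually_lt_of_limsup_lt hlt (isBoundedUnder_le_window E s))
  have hind : ∀ q : ℕ, ((E ∩ Set.Icc 0 (k₀ + q * s)).ncard : ℝ) ≤
      k₀ + 1 + q * (δ / 2 * s) := by
    intro q
    induction q with
    | zero =>
      have := ncard_inter_Icc_zero_le E k₀
      simp only [zero_mul, add_zero, Nat.cast_zero]
      exact_mod_cast this
    | succ q ih =>
      have h1 := ncard_inter_Icc_zero_add_le E (k₀ + q * s) s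
      have h2 := (div_lt_iff₀ hsR).1 (hk₀ (k₀ + q * s) (Nat.le_add_right _ _))
      have h3 : k₀ + (q + 1) * s = k₀ + q * s + s := by ring
      rw [h3]
      have h1' : ((E ∩ Set.Icc 0 (k₀ + q * s + s)).ncard : ℝ) ≤
        (E ∩ Set.Icc 0 (k₀ + q * s)).ncard
          + (E ∩ Set.Icc (k₀ + q * s + 1) (k₀ + q * s + s)).ncard := by exact_mod_cast h1
      push_cast
      linarith
  have hbound : ∀ n : ℕ, ((E ∩ Set.Icc 0 n).ncard : ℝ) ≤
      k₀ + 1 + δ / 2 * s + δ / 2 * n := by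
    intro n
    have h1 : n < s * (n / s + 1) := Nat.lt_mul_div_succ n hs
    have h2 : (E ∩ Set.Icc 0 n).ncard ≤ (E ∩ Set.Icc 0 (k₀ + (n / s + 1) * s)).ncard := by
      refine Set.ncard_le_ncard ?_ ((Set.finite_Icc _ _).inter_of_right _)
      refine Set.inter_subset_inter_right _ (Set.Icc_subset_Icc_right ?_)
      rw [mul_comm]
      omega
    have h3 : (((n / s : ℕ) : ℝ)) * s ≤ n := by exact_mod_cast Nat.div_mul_le_self n s
    have h4 := hind (n / s + 1)
    have h5 : δ / 2 * (((n / s : ℕ) : ℝ) * s) ≤ δ / 2 * n :=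
      mul_le_mul_of_nonneg_left h3 (by positivity)
    push_cast at h4
    have h2' : ((E ∩ Set.Icc 0 n).ncard : ℝ) ≤ (E ∩ Set.Icc 0 (k₀ + (n / s + 1) * s)).ncard := by
      exact_mod_cast h2
    linarith
  have hev : ∀ᶠ n : ℕ in atTop, ((E ∩ Set.Icc 0 n).ncard : ℝ) / (n : ℝ) ≤ 3 / 4 * δ := by
    have ht := tendsto_natCast_atTop_atTop (R := ℝ)
    filter_upwards [ht.eventually_ge_atTop ((k₀ + 1 + δ / 2 * s) / (δ / 4)),
      eventually_gt_atTop 0] with n hn hn0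
    have hnR : (0 : ℝ) < n := by exact_mod_cast hn0
    rw [div_le_iff₀ hnR]
    rw [div_le_iff₀ (by positivity)] at hn
    have := hbound n
    linarith
  have : δ ≤ 3 / 4 * δ :=
    limsup_le_of_le (isBoundedUnder_ge_density_quotient E).isCoboundedUnder_le hev
  linarith

theorem upperBanachDensity_pos {E : Set ℕ} (hE : 0 < upperDensity E) :
    0 < upperBanachDensity E :=
  lt_of_lt_of_le (half_pos hE) (ge_of_tendsto (tendsto_upperBanachDensity E)
    ((eventually_gt_atTop 0).mono fun _ hs => half_upperDensity_le_windowDensity hE hs))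

/-! ### Well separated sets of positive lower density -/

/-- The sum is the 2-adic valuation of `m!`, which Legendre's formula bounds by `m`. It makes the
colouring below have bounded average cost. -/
theorem sum_padicValNat_two_le (m : ℕ) :
    ∑ i ∈ Finset.range m, padicValNat 2 (i + 1) ≤ m := by
  have h : ∀ m : ℕ, ∑ i ∈ Finset.range m, padicValNat 2 (i + 1) =
      padicValNat 2 m.factorial := by
    intro m
    induction m with
    | zero => simp
    | succ m ih =>
      rw [Finset.sum_range_succ, ih, Nat.factorial_succ,
        padicValNat.mul (Nat.succ_ne_zero m) (Nat.factorial_ne_zero m), add_comm]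
  rw [h]
  have := sub_one_mul_padicValNat_factorial (p := 2) m
  omega

theorem exists_strictMono_ge (N : ℕ → ℕ) : ∃ t : ℕ → ℕ, StrictMono t ∧ ∀ j, N j ≤ t j := by
  refine ⟨fun j => ∑ i ∈ Finset.range (j + 1), (N i + 1), strictMono_nat_of_lt_succ fun j => ?_,
    fun j => ?_⟩
  · change _ < ∑ i ∈ Finset.range (j + 1 + 1), (N i + 1)
    rw [Finset.sum_range_succ (n := j + 1)]
    omega
  · change _ ≤ ∑ i ∈ Finset.range (j + 1), (N i + 1)
    rw [Finset.sum_range_succ]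
    omega

/-- The integers can be coloured so that every colour class has a linear enumeration, while
colours with large `N` are rare. -/
theorem exists_colouring (N : ℕ → ℕ) : ∃ ρ : ℕ → ℕ, ∃ C : ℕ,
    (∀ m, ∑ i ∈ Finset.range m, N (ρ i) ≤ C * m) ∧
    ∀ j, ∃ a : ℕ → ℕ, Function.Injective a ∧ (∀ q, ρ (a q) = j) ∧
      ∃ L, ∀ q, a q + 1 ≤ L * (q + 1) := by
  obtain ⟨t, ht, hN⟩ := exists_strictMono_ge N
  -- Colour `j` is given to the integers `m` for which `m + 1` has 2-adic valuation `t j ≥ N j`.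
  -- Valuations outside the range of `t` default to colour `0`, whence the extra `N 0` in the
  -- bounds.
  let g : ℕ → ℕ := Function.extend t id 0
  have hg : ∀ j, g (t j) = j := fun j => ht.injective.extend_apply _ _ _
  have hgN : ∀ v, N (g v) ≤ v + N 0 := by
    intro v
    by_cases h : ∃ j, t j = v
    · obtain ⟨j, rfl⟩ := h
      rw [hg]
      exact (hN j).trans (Nat.le_add_right _ _)
    · have : g v = 0 := Function.extend_apply' _ _ _ h
      rw [this]
      exact Nat.le_add_left _ _
  refine ⟨fun m => g (padicValNat 2 (m + 1)), 1 + N 0, fun m => ?_, fun j => ?_⟩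
  · calc ∑ i ∈ Finset.range m, N (g (padicValNat 2 (i + 1)))
        ≤ ∑ i ∈ Finset.range m, (padicValNat 2 (i + 1) + N 0) :=
          Finset.sum_le_sum fun i _ => hgN _
      _ = (∑ i ∈ Finset.range m, padicValNat 2 (i + 1)) + m * N 0 := by
          rw [Finset.sum_add_distrib, Finset.sum_const, Finset.card_range, smul_eq_mul]
      _ ≤ m + m * N 0 := Nat.add_le_add_right (sum_padicValNat_two_le m) _
      _ = (1 + N 0) * m := by ring
  · have hpos : ∀ q, 0 < 2 ^ t j * (2 * q + 1) := fun q => by positivity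
    have hsucc : ∀ q, 2 ^ t j * (2 * q + 1) - 1 + 1 = 2 ^ t j * (2 * q + 1) := fun q => by
      have := hpos q
      omega
    refine ⟨fun q => 2 ^ t j * (2 * q + 1) - 1, fun q r h => ?_, fun q => ?_,
      2 * 2 ^ t j, fun q => ?_⟩
    · have h1 : 2 ^ t j * (2 * q + 1) = 2 ^ t j * (2 * r + 1) := by
        rw [← hsucc q, ← hsucc r]
        exact congrArg (· + 1) h
      have := Nat.eq_of_mul_eq_mul_left (by positivity) h1
      omega
    · change g (padicValNat 2 (2 ^ t j * (2 * q + 1) - 1 + 1)) = j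
      rw [hsucc, padicValNat.mul (by positivity) (by positivity), padicValNat.prime_pow,
        padicValNat.eq_zero_of_not_dvd (show ¬2 ∣ 2 * q + 1 by omega), add_zero, hg]
    · change 2 ^ t j * (2 * q + 1) - 1 + 1 ≤ _
      rw [hsucc]
      calc 2 ^ t j * (2 * q + 1) ≤ 2 ^ t j * (2 * (q + 1)) := Nat.mul_le_mul_left _ (by omega)
        _ = 2 * 2 ^ t j * (q + 1) := by ring

/-- Disjoint sets of positive lower density whose elements are prescribed distances apart. -/
theorem exists_separated_sets (N : ℕ → ℕ) : ∃ A : ℕ → Set ℕ,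
    (∀ j, 0 < lowerDensity (A j)) ∧ (∀ j, ∀ n ∈ A j, N j ≤ n) ∧
    (∀ j l n, n ∈ A j → n ∈ A l → j = l) ∧
    ∀ j l n m, n ∈ A j → m ∈ A l → n < m → n + N j ≤ m ∧ n + N l ≤ m := by
  obtain ⟨ρ, C, hC, hρ⟩ := exists_colouring N
  -- Consecutive values differ by `N (ρ m) + N (ρ (m + 1)) + 1`, so every point keeps its own
  -- distance on both sides. The second sum runs up to `m` inclusive, which also gives `N (ρ m) ≤ φ
  -- m`.
  let φ : ℕ → ℕ := fun m => (∑ i ∈ Finset.range m, (N (ρ i) + 1)) +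
    ∑ i ∈ Finset.range (m + 1), N (ρ i)
  have hstep : ∀ m, φ (m + 1) = φ m + N (ρ m) + N (ρ (m + 1)) + 1 := by
    intro m
    simp only [φ, Finset.sum_range_succ]
    ring
  have hφ : StrictMono φ := strictMono_nat_of_lt_succ fun m => by
    rw [hstep]
    omega
  have hNφ : ∀ m, N (ρ m) ≤ φ m := by
    intro m
    simp only [φ, Finset.sum_range_succ]
    omega
  have hlin : ∀ m, φ m ≤ (2 * C + 1) * (m + 1) := by
    intro m
    have h1 := hC m
    have h2 := hC (m + 1)
    have h3 : ∑ i ∈ Finset.range m, (N (ρ i) + 1) = (∑ i ∈ Finset.range m, N (ρ i)) + m := by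
      rw [Finset.sum_add_distrib, Finset.sum_const, Finset.card_range, smul_eq_mul, mul_one]
    simp only [φ]
    rw [h3]
    nlinarith
  have hsep : ∀ a b, a < b → φ a + N (ρ a) ≤ φ b ∧ φ a + N (ρ b) ≤ φ b := by
    intro a b hab
    obtain ⟨b, rfl⟩ : ∃ c, b = c + 1 := ⟨b - 1, by omega⟩
    have h1 := hstep a
    have h2 := hstep b
    have h3 : φ (a + 1) ≤ φ (b + 1) := hφ.monotone hab
    have h4 : φ a ≤ φ b := hφ.monotone (by omega)
    omega
  refine ⟨fun j => φ '' {m | ρ m = j}, fun j => ?_, ?_, ?_, ?_⟩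
  · obtain ⟨a, ha, haj, L, hL⟩ := hρ j
    refine lowerDensity_pos_of_injective (a := φ ∘ a) (L := (2 * C + 1) * L)
      (hφ.injective.comp ha) (fun q => ⟨a q, haj q, rfl⟩) ?_ fun q => ?_
    · have : 0 < L := Nat.pos_of_ne_zero fun h => by
        have := hL 0
        simp [h] at this
      positivity
    · rw [mul_assoc]
      exact (hlin (a q)).trans (Nat.mul_le_mul_left _ (hL q))
  · rintro j _ ⟨m, rfl, rfl⟩
    exact hNφ m
  · rintro j l n ⟨m, rfl, rfl⟩ ⟨m', rfl, h⟩
    rw [hφ.injective h]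
  · rintro j l _ _ ⟨a, rfl, rfl⟩ ⟨b, rfl, rfl⟩ h
    exact hsep a b (hφ.lt_iff_lt.1 h)

/-! ### A shift-invariant mean along windows of positive density -/

theorem ncard_window_eq_sum (E : Set ℕ) (k s : ℕ) :
    ((E ∩ Set.Icc (k + 1) (k + s)).ncard : ℝ) =
      ∑ i ∈ Finset.range s, E.indicator (1 : ℕ → ℝ) (k + 1 + i) := by
  classical
  have h : E ∩ Set.Icc (k + 1) (k + s) =
      ((Finset.range s).filter fun i => k + 1 + i ∈ E).image (fun i => k + 1 + i) := by
    ext x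
    simp only [Set.mem_inter_iff, Set.mem_Icc, Finset.coe_image, Finset.coe_filter,
      Finset.mem_range, Set.mem_image, Set.mem_ofPred_eq]
    constructor
    · rintro ⟨hx, h1, h2⟩
      have h3 : k + 1 + (x - (k + 1)) = x := by omega
      exact ⟨x - (k + 1), ⟨by omega, by rwa [h3]⟩, h3⟩
    · rintro ⟨i, ⟨hi, hiE⟩, rfl⟩
      exact ⟨hiE, by omega, by omega⟩
  rw [h, Set.ncard_coe_finset, Finset.card_image_of_injective _ (add_right_injective _),
    Finset.card_filter, Nat.cast_sum]
  refine Finset.sum_congr rfl fun i _ => ?_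
  by_cases hi : k + 1 + i ∈ E <;> simp [hi]

theorem exists_windows {E : Set ℕ} (hE : 0 < upperBanachDensity E) :
    ∃ β : ℝ, 0 < β ∧ ∃ k : ℕ → ℕ, ∀ᶠ s : ℕ in atTop,
      β ≤ (∑ i ∈ Finset.range s, E.indicator (1 : ℕ → ℝ) (k s + 1 + i)) / s := by
  have h : ∀ᶠ s : ℕ in atTop, ∃ k : ℕ, upperBanachDensity E / 2 ≤
      (∑ i ∈ Finset.range s, E.indicator (1 : ℕ → ℝ) (k + 1 + i)) / s := by
    filter_upwards [(tendsto_upperBanachDensity E).eventually_const_lt (half_lt_self hE)] with s hs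
    obtain ⟨k, hk⟩ := (frequently_lt_of_lt_limsup (isCoboundedUnder_le_window E s) hs).exists
    exact ⟨k, by rw [← ncard_window_eq_sum]; exact hk.le⟩
  refine ⟨_, half_pos hE, fun s => Classical.epsilon fun k : ℕ => upperBanachDensity E / 2 ≤
      (∑ i ∈ Finset.range s, E.indicator (1 : ℕ → ℝ) (k + 1 + i)) / s, ?_⟩
  filter_upwards [h] with s hs
  exact Classical.epsilon_spec hs

/-- `L A` is the limit, along a free ultrafilter, of the averages of `A` over windows of growing
length that are dense in `E`. A shift changes an average only by boundary terms of size at most `1 /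
s`. The last clause packages positivity, linearity and normalisation: pointwise bounds on
combinations of indicators pass to `L`. -/
theorem exists_invariant_mean {E : Set ℕ} (hE : 0 < upperBanachDensity E) :
    ∃ L : Set ℕ → ℝ, 0 < L E ∧ (∀ A d, L {n | n + d ∈ A} = L A) ∧
      ∀ (ι : Type) (I : Finset ι) (c : ι → ℝ) (A : ι → Set ℕ) (C : ℝ),
        (∀ n, ∑ i ∈ I, c i * (A i).indicator (1 : ℕ → ℝ) n ≤ C) →
          ∑ i ∈ I, c i * L (A i) ≤ C := by
  obtain ⟨β, hβ, k, hk⟩ := exists_windows hE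
  let U : Ultrafilter ℕ := hyperfilter ℕ
  have hU : (U : Filter ℕ) ≤ atTop := by
    rw [← Nat.cofinite_eq_atTop]
    exact hyperfilter_le_cofinite
  let a : Set ℕ → ℕ → ℝ := fun A s =>
    (∑ i ∈ Finset.range s, A.indicator (1 : ℕ → ℝ) (k s + 1 + i)) / s
  have hind : ∀ (A : Set ℕ) n, 0 ≤ A.indicator (1 : ℕ → ℝ) n ∧ A.indicator (1 : ℕ → ℝ) n ≤ 1 := by
    intro A n
    by_cases h : n ∈ A <;> simp [h]
  have ha0 : ∀ A s, 0 ≤ a A s := fun A s =>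
    div_nonneg (Finset.sum_nonneg fun i _ => (hind A _).1) (Nat.cast_nonneg s)
  have ha1 : ∀ A s, a A s ≤ 1 := fun A s => by
    refine div_le_one_of_le₀ ?_ (Nat.cast_nonneg s)
    refine (Finset.sum_le_card_nsmul _ _ 1 fun i _ => (hind A _).2).trans ?_
    simp
  have hlim : ∀ A, ∃ l, Tendsto (a A) U (𝓝 l) := by
    intro A
    obtain ⟨l, -, hl⟩ := (isCompact_Icc (a := (0 : ℝ)) (b := 1)).ultrafilter_le_nhds (U.map (a A))
      (le_principal_iff.2 (by
        rw [Ultrafilter.coe_map]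
        exact mem_map.2 (univ_mem' fun s => ⟨ha0 A s, ha1 A s⟩)))
    exact ⟨l, by rwa [Ultrafilter.coe_map] at hl⟩
  choose L hL using hlim
  refine ⟨L, lt_of_lt_of_le hβ (ge_of_tendsto (hL E) (hU hk)), ?_, ?_⟩
  · have hone : ∀ A, L {n | n + 1 ∈ A} = L A := by
      intro A
      have hdiff : ∀ s, a {n | n + 1 ∈ A} s = a A s + (A.indicator (1 : ℕ → ℝ) (k s + 1 + s)
          - A.indicator (1 : ℕ → ℝ) (k s + 1)) / s := by
        intro s
        have h1 := Finset.sum_range_succ (fun i => A.indicator (1 : ℕ → ℝ) (k s + 1 + i)) s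
        have h2 := Finset.sum_range_succ' (fun i => A.indicator (1 : ℕ → ℝ) (k s + 1 + i)) s
        have h3 : ∀ i, ({n | n + 1 ∈ A} : Set ℕ).indicator (1 : ℕ → ℝ) (k s + 1 + i) =
            A.indicator (1 : ℕ → ℝ) (k s + 1 + (i + 1)) := fun i => rfl
        simp only [a, h3]
        rw [← add_div]
        congr 1
        simp only [add_zero] at h2
        linarith
      have hz : Tendsto (fun s : ℕ => (A.indicator (1 : ℕ → ℝ) (k s + 1 + s)
          - A.indicator (1 : ℕ → ℝ) (k s + 1)) / s) U (𝓝 0) := by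
        refine squeeze_zero_norm (a := fun s : ℕ => 1 / (s : ℝ)) (fun s => ?_)
          ((tendsto_const_div_atTop_nhds_zero_nat 1).mono_left hU)
        rw [norm_div, Real.norm_eq_abs, Real.norm_natCast]
        refine div_le_div_of_nonneg_right (abs_le.2 ?_) (Nat.cast_nonneg s)
        have h1 := hind A (k s + 1 + s)
        have h2 := hind A (k s + 1)
        constructor <;> linarith [h1.1, h1.2, h2.1, h2.2]
      have h := (hL A).add hz
      rw [add_zero] at h
      exact tendsto_nhds_unique (hL _) (h.congr fun s => (hdiff s).symm)
    intro A d
    induction d with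
    | zero => rfl
    | succ d ih =>
      rw [← ih, ← hone {n | n + d ∈ A}]
      congr 1
      ext n
      simp only [Set.mem_ofPred_eq]
      rw [add_right_comm, add_assoc]
  · intro ι I c A C h
    refine le_of_tendsto (tendsto_finsetSum I fun i _ => (hL (A i)).const_mul (c i))
      (hU ?_)
    filter_upwards [eventually_gt_atTop 0] with s hs
    have hs' : (0 : ℝ) < s := by exact_mod_cast hs
    have heq : ∑ i ∈ I, c i * a (A i) s = (∑ j ∈ Finset.range s,
        ∑ i ∈ I, c i * (A i).indicator (1 : ℕ → ℝ) (k s + 1 + j)) / s := by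
      simp only [a]
      rw [Finset.sum_comm, Finset.sum_div]
      refine Finset.sum_congr rfl fun i _ => ?_
      rw [← mul_div_assoc, Finset.mul_sum]
    rw [heq, div_le_iff₀ hs']
    refine (Finset.sum_le_card_nsmul _ _ C fun j _ => h _).trans ?_
    simp [mul_comm]

/-! ### Differences that recur with positive frequency -/

/-- With `S` the sum of the indicators, `2 * S - S * S ≤ 1` pointwise. Expanding `S * S` puts
coefficient `1` on the diagonal pairs and `-1` on the others; the mean of this inequality gives the
bound. -/
theorem card_mul_le_of_small_intersections {L : Set ℕ → ℝ}
    (hL : ∀ (ι : Type) (I : Finset ι) (c : ι → ℝ) (A : ι → Set ℕ) (C : ℝ),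
        (∀ n, ∑ i ∈ I, c i * (A i).indicator (1 : ℕ → ℝ) n ≤ C) →
          ∑ i ∈ I, c i * L (A i) ≤ C)
    {A : ℕ → Set ℕ} {β δ : ℝ} (hδ : 0 ≤ δ) (F : Finset ℕ) (hA : ∀ f ∈ F, β ≤ L (A f))
    (hF : ∀ f ∈ F, ∀ f' ∈ F, f ≠ f' → L (A f ∩ A f') ≤ δ) :
    F.card * β ≤ 1 + F.card * (F.card * δ) := by
  have h := hL (ℕ × ℕ) (F ×ˢ F) (fun q => if q.1 = q.2 then 1 else -1)
    (fun q => A q.1 ∩ A q.2) 1 ?_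
  · have h2 : ∑ q ∈ F ×ˢ F, ((if q.1 = q.2 then β else 0) - δ) ≤
        ∑ q ∈ F ×ˢ F, (if q.1 = q.2 then 1 else -1) * L (A q.1 ∩ A q.2) := by
      refine Finset.sum_le_sum fun q hq => ?_
      obtain ⟨h1, h2⟩ := Finset.mem_product.1 hq
      by_cases hqq : q.1 = q.2
      · rw [if_pos hqq, if_pos hqq, ← hqq, Set.inter_self, one_mul]
        linarith [hA _ h1]
      · rw [if_neg hqq, if_neg hqq]
        linarith [hF _ h1 _ h2 hqq]
    have h3 : ∑ q ∈ F ×ˢ F, ((if q.1 = q.2 then β else 0) - δ) =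
        F.card * β - F.card * (F.card * δ) := by
      rw [Finset.sum_sub_distrib, Finset.sum_product]
      simp [mul_assoc]
    linarith
  · intro n
    set S : ℝ := ∑ f ∈ F, (A f).indicator (1 : ℕ → ℝ) n with hS
    have hpt : ∀ q : ℕ × ℕ, (if q.1 = q.2 then (1 : ℝ) else -1) *
        (A q.1 ∩ A q.2).indicator (1 : ℕ → ℝ) n =
        (if q.1 = q.2 then 2 * (A q.1).indicator (1 : ℕ → ℝ) n else 0) -
          (A q.1).indicator (1 : ℕ → ℝ) n * (A q.2).indicator (1 : ℕ → ℝ) n := by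
      rintro ⟨f, f'⟩
      rw [← Set.inter_indicator_mul]
      by_cases hff : f = f'
      · subst hff
        by_cases hn : n ∈ A f <;> simp [hn]
        norm_num
      · by_cases hn : n ∈ A f <;> by_cases hn' : n ∈ A f' <;> simp [hff, hn, hn']
    have heq : ∑ q ∈ F ×ˢ F, (if q.1 = q.2 then (1 : ℝ) else -1) *
        (A q.1 ∩ A q.2).indicator (1 : ℕ → ℝ) n = 2 * S - S * S := by
      rw [Finset.sum_congr rfl fun q _ => hpt q, Finset.sum_sub_distrib, Finset.sum_product,
        Finset.sum_product, hS, Finset.sum_mul_sum, Finset.mul_sum]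
      simp
    rw [heq]
    nlinarith [sq_nonneg (S - 1)]

/-- If the good differences had unbounded gaps, one could choose greedily `k` translates of `E` with
pairwise intersections of mean at most `δ`. All translates have mean `L E`, so this contradicts
`card_mul_le_of_small_intersections` for large `k`. -/
theorem exists_recurrent_difference {L : Set ℕ → ℝ} {E : Set ℕ} (hE : 0 < L E)
    (hshift : ∀ A d, L {n | n + d ∈ A} = L A)
    (hL : ∀ (ι : Type) (I : Finset ι) (c : ι → ℝ) (A : ι → Set ℕ) (C : ℝ),
        (∀ n, ∑ i ∈ I, c i * (A i).indicator (1 : ℕ → ℝ) n ≤ C) →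
          ∑ i ∈ I, c i * L (A i) ≤ C) :
    ∃ δ : ℝ, 0 < δ ∧ ∃ K : ℕ, ∀ n ≥ K, ∃ f ≤ K, δ ≤ L (E ∩ {m | m + (n - f) ∈ E}) := by
  obtain ⟨k, hk⟩ := exists_nat_gt (2 / L E)
  have hk0 : (0 : ℝ) < k := lt_trans (by positivity) hk
  rw [div_lt_iff₀ hE] at hk
  -- Then `k * (k * δ) = 1 / 2`, while `k * L E > 2`: the counting inequality would read `2 < 1 + 1
  -- / 2`.
  set δ : ℝ := 1 / (2 * (k * k)) with hδ
  have hδ0 : 0 < δ := by positivity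
  refine ⟨δ, hδ0, ?_⟩
  by_contra! hcon
  have hbuild : ∀ j : ℕ, ∃ F : Finset ℕ, F.card = j ∧
      ∀ f ∈ F, ∀ f' ∈ F, f < f' → L ({m | m + f ∈ E} ∩ {m | m + f' ∈ E}) ≤ δ := by
    intro j
    induction j with
    | zero => exact ⟨∅, by simp⟩
    | succ j ih =>
      obtain ⟨F, hFj, hF⟩ := ih
      obtain ⟨n, hn, hnF⟩ := hcon (F.sup id + 1)
      have hle : ∀ f ∈ F, f < n := fun f hf => by
        have : f ≤ F.sup id := Finset.le_sup (f := id) hf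
        omega
      refine ⟨insert n F, ?_, ?_⟩
      · rw [Finset.card_insert_of_notMem fun h => lt_irrefl _ (hle n h), hFj]
      · intro f hf f' hf' hlt
        rcases Finset.mem_insert.1 hf' with rfl | hmem
        · have hfF : f ∈ F := Finset.mem_of_mem_insert_of_ne hf hlt.ne
          have h1 : f ≤ F.sup id := Finset.le_sup (f := id) hfF
          have h2 := hnF f (by omega)
          rw [← hshift _ f] at h2
          refine le_of_eq_of_le (congrArg L ?_) h2.le
          ext m
          have : m + f + (f' - f) = m + f' := by omega
          simp [this]
        · refine hF f (Finset.mem_of_mem_insert_of_ne hf ?_) f' hmem hlt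
          rintro rfl
          exact lt_asymm hlt (hle _ hmem)
  obtain ⟨F, hFk, hF⟩ := hbuild k
  have h := card_mul_le_of_small_intersections hL hδ0.le (A := fun f => {m | m + f ∈ E}) F
    (fun f _ => (hshift E f).ge) fun f hf f' hf' hne => by
      rcases lt_or_gt_of_ne hne with h | h
      · exact hF f hf f' hf' h
      · rw [Set.inter_comm]
        exact hF f' hf' f hf h
  rw [hFk] at h
  have h2 : (k : ℝ) * (k * δ) = 1 / 2 := by
    rw [hδ]
    field_simp
  linarith

/-- Averaging the hypothesis on `g` over `n ∈ E` bounds the sum of `g d * L (E ∩ (E - d))`, and on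
`D` the second factor is at least `δ`. The two alternatives look forward and backward from `n`. -/
theorem exists_recurrent_differences {E : Set ℕ} (hE : 0 < upperBanachDensity E) :
    ∃ D : Set ℕ, (∃ K : ℕ, ∀ n ≥ K, ∃ f ≤ K, n - f ∈ D) ∧
      ∀ g : ℕ → ℝ, (∀ d, 0 ≤ g d) → ∀ C : ℝ,
        ((∀ n ∈ E, ∀ N, ∑ d ∈ Finset.range N, {d | n + d ∈ E}.indicator g d ≤ C) ∨
          ∀ n ∈ E, ∀ N, ∑ d ∈ Finset.range N, {d | d ≤ n ∧ n - d ∈ E}.indicator g d ≤ C) →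
        Summable (D.indicator g) := by
  obtain ⟨L, hLE, hshift, hL⟩ := exists_invariant_mean hE
  obtain ⟨δ, hδ, K, hK⟩ := exists_recurrent_difference hLE hshift hL
  refine ⟨{d | δ ≤ L (E ∩ {m | m + d ∈ E})}, ⟨K, hK⟩, fun g hg C hC => ?_⟩
  have hkey : ∃ C', ∀ N, ∑ d ∈ Finset.range N, g d * L (E ∩ {m | m + d ∈ E}) ≤ C' := by
    refine ⟨max C 0, fun N => ?_⟩
    rcases hC with hC | hC
    · refine hL ℕ _ _ _ _ fun n => ?_
      by_cases hn : n ∈ E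
      · refine le_trans (le_of_eq (Finset.sum_congr rfl fun d _ => ?_))
          ((hC n hn N).trans (le_max_left _ _))
        by_cases hd : n + d ∈ E <;> simp [hn, hd]
      · simp [hn]
    · have heq : ∀ d, L (E ∩ {m | m + d ∈ E}) = L (E ∩ {n | d ≤ n ∧ n - d ∈ E}) := by
        intro d
        rw [← hshift (E ∩ {n | d ≤ n ∧ n - d ∈ E}) d]
        congr 1
        ext m
        simp [and_comm]
      simp only [heq]
      refine hL ℕ _ _ _ _ fun n => ?_
      by_cases hn : n ∈ E
      · refine le_trans (le_of_eq (Finset.sum_congr rfl fun d _ => ?_))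
          ((hC n hn N).trans (le_max_left _ _))
        by_cases hd : d ≤ n ∧ n - d ∈ E
        · simp [hn, hd]
        · simp only [Set.indicator, Set.mem_inter_iff, Set.mem_ofPred_eq, hn, hd]
          simp
      · simp [hn]
  obtain ⟨C', hC'⟩ := hkey
  have hnn : ∀ A : Set ℕ, 0 ≤ L A := by
    intro A
    have := hL Unit {()} (fun _ => -1) (fun _ => A) 0 fun n => by
      by_cases hn : n ∈ A <;> simp [hn]
    simpa using this
  refine summable_of_sum_range_le (c := C' / δ) (fun d => Set.indicator_nonneg (fun d _ => hg d) d)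
    fun N => ?_
  rw [le_div_iff₀ hδ, Finset.sum_mul]
  refine (Finset.sum_le_sum fun d _ => ?_).trans (hC' N)
  by_cases hd : δ ≤ L (E ∩ {m | m + d ∈ E})
  · rw [Set.indicator_of_mem (by exact hd)]
    exact mul_le_mul_of_nonneg_left hd (hg d)
  · rw [Set.indicator_of_notMem (by exact hd), zero_mul]
    exact mul_nonneg (hg d) (hnn _)

/-- Every interval `[n, n + K]` meets `D`. Moving from its left or right end to a point of `D` costs
at most `R ^ K`, so `g` is dominated by a finite sum of shifts of `D.indicator g`. -/
theorem summable_of_summable_indicator {D : Set ℕ} {K : ℕ} (hK : ∀ n ≥ K, ∃ f ≤ K, n - f ∈ D)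
    {g : ℕ → ℝ} (hg : ∀ d, 0 ≤ g d) {R : ℝ} (hR : 1 ≤ R)
    (hgR : (∀ d, g d ≤ R * g (d + 1)) ∨ ∀ d, g (d + 1) ≤ R * g d)
    (hD : Summable (D.indicator g)) : Summable g := by
  have hR0 : 0 ≤ R := zero_le_one.trans hR
  have hsum : Summable fun n => R ^ K * ∑ i ∈ Finset.range (K + 1), D.indicator g (n + i) :=
    (summable_sum fun i _ => (summable_nat_add_iff i).2 hD).mul_left _
  have hmem : ∀ n, ∃ i ≤ K, n + i ∈ D := by
    intro n
    obtain ⟨f, hf, hfD⟩ := hK (n + K) (Nat.le_add_left _ _)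
    exact ⟨K - f, Nat.sub_le _ _, by rwa [Nat.add_sub_assoc hf] at hfD⟩
  have hle : ∀ n i, i ≤ K → n + i ∈ D → ∀ j ≤ K, R ^ j * g (n + i) ≤
      R ^ K * ∑ i ∈ Finset.range (K + 1), D.indicator g (n + i) := by
    intro n i hi hiD j hj
    refine mul_le_mul (pow_le_pow_right₀ hR hj) ?_ (hg _) (by positivity)
    rw [← Set.indicator_of_mem hiD g]
    exact Finset.single_le_sum (f := fun i => D.indicator g (n + i))
      (fun i _ => Set.indicator_nonneg (fun d _ => hg d) _) (Finset.mem_range.2 (by omega))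
  rcases hgR with h | h
  · have hpow : ∀ n j, g n ≤ R ^ j * g (n + j) := by
      intro n j
      induction j with
      | zero => simp
      | succ j ih =>
        refine ih.trans ?_
        rw [pow_succ, mul_assoc]
        exact mul_le_mul_of_nonneg_left (h _) (by positivity)
    refine Summable.of_nonneg_of_le hg (fun n => ?_) hsum
    obtain ⟨i, hi, hiD⟩ := hmem n
    exact (hpow n i).trans (hle n i hi hiD i hi)
  · have hpow : ∀ n j, g (n + j) ≤ R ^ j * g n := by
      intro n j
      induction j with
      | zero => simp
      | succ j ih =>
        refine (h _).trans ?_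
        rw [pow_succ', mul_assoc]
        exact mul_le_mul_of_nonneg_left ih hR0
    refine (summable_nat_add_iff K).1 (Summable.of_nonneg_of_le (fun n => hg _) (fun n => ?_) hsum)
    obtain ⟨i, hi, hiD⟩ := hmem n
    have := hpow (n + i) (K - i)
    rw [add_assoc, Nat.add_sub_cancel' hi] at this
    exact this.trans (hle n i hi hiD _ (Nat.sub_le _ _))

/-- If the partial sums of `g` over the differences in a set of positive upper Banach density are
bounded, and `g` varies at most geometrically, then `g` is summable. -/
theorem summable_of_sum_differences_le {E : Set ℕ} (hE : 0 < upperBanachDensity E)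
    {g : ℕ → ℝ} (hg : ∀ d, 0 ≤ g d) {R : ℝ}
    (hgR : (∀ d, g d ≤ R * g (d + 1)) ∨ ∀ d, g (d + 1) ≤ R * g d) {C : ℝ}
    (hC : (∀ n ∈ E, ∀ N, ∑ d ∈ Finset.range N, {d | n + d ∈ E}.indicator g d ≤ C) ∨
      ∀ n ∈ E, ∀ N, ∑ d ∈ Finset.range N, {d | d ≤ n ∧ n - d ∈ E}.indicator g d ≤ C) :
    Summable g := by
  obtain ⟨D, ⟨K, hK⟩, hD⟩ := exists_recurrent_differences hE
  refine summable_of_summable_indicator hK hg (le_max_right R 1) ?_ (hD g hg C hC)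
  have h : ∀ d, R * g d ≤ max R 1 * g d := fun d =>
    mul_le_mul_of_nonneg_right (le_max_left _ _) (hg d)
  exact hgR.imp (fun h' d => (h' d).trans (h _)) fun h' d => (h' d).trans (h _)

/-! ### The frequent hypercyclicity criterion -/

theorem exists_tail_bound {X : Type*} [NormedAddCommGroup X] [CompleteSpace X] {u : ℕ → X} (hu : Summable u) {ε : ℝ} (hε : 0 < ε) :
    ∃ N, ∀ F : Finset ℕ, (∀ m ∈ F, N ≤ m) → ‖∑ m ∈ F, u m‖ ≤ ε := by
  obtain ⟨s, hs⟩ := summable_iff_vanishing_norm.1 hu ε hε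
  refine ⟨s.sup id + 1, fun F hF => (hs F (Finset.disjoint_left.2 fun m hm hms => ?_)).le⟩
  have h1 := hF m hm
  have h2 : m ≤ s.sup id := Finset.le_sup (f := id) hms
  omega

section Criterion

variable {X : Type*} [NormedAddCommGroup X] [NormedSpace ℂ X]

theorem pow_apply_backward_orbit {T : X →L[ℂ] X} {u : ℕ → X} (hu : ∀ n, T (u (n + 1)) = u n)
    (n k : ℕ) : (T ^ n) (u (n + k)) = u k := by
  induction n with
  | zero => simp
  | succ n ih => rw [pow_succ, mul_apply_eq_comp, add_right_comm, hu, ih]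

/-- The partial sums of `T ^ n` applied to a backward orbit, sampled away from `n`. -/
theorem norm_sum_pow_backward_orbit_le {T : X →L[ℂ] X} {u : ℕ → X}
    (hu : ∀ n, T (u (n + 1)) = u n) {ε : ℝ} {N : ℕ}
    (h1 : ∀ F : Finset ℕ, (∀ m ∈ F, N ≤ m) → ‖∑ m ∈ F, u m‖ ≤ ε)
    (h2 : ∀ F : Finset ℕ, (∀ m ∈ F, N ≤ m) → ‖∑ m ∈ F, (T ^ m) (u 0)‖ ≤ ε)
    (n : ℕ) (F : Finset ℕ) (hF : ∀ m ∈ F, m ≠ n → m + N ≤ n ∨ n + N ≤ m) (hn : n ∉ F) :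
    ‖∑ m ∈ F, (T ^ n) (u m)‖ ≤ 2 * ε := by
  -- For `m < n` the term is `(T ^ (n - m)) (u 0)`, for `m > n` it is `u (m - n)`. Separation from
  -- `n` turns both halves into tails, of the forward and the backward orbit.
  rw [← Finset.sum_filter_add_sum_filter_not F (fun m => m < n), two_mul]
  refine (norm_add_le _ _).trans (add_le_add ?_ ?_)
  · have hlt : ∀ m ∈ F.filter (fun m => m < n), m < n := fun m hm => (Finset.mem_filter.1 hm).2
    have hinj : Set.InjOn (fun m => n - m) (F.filter (fun m => m < n) : Set ℕ) := by
      intro a ha b hb hab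
      have := hlt a ha
      have := hlt b hb
      have : n - a = n - b := hab
      omega
    have heq : ∑ m ∈ F.filter (fun m => m < n), (T ^ n) (u m) =
        ∑ m ∈ (F.filter (fun m => m < n)).image (fun m => n - m), (T ^ m) (u 0) := by
      rw [Finset.sum_image hinj]
      refine Finset.sum_congr rfl fun m hm => ?_
      have h : n = (n - m) + m := by
        have := hlt m hm
        omega
      conv_lhs => rw [h, pow_add, mul_apply_eq_comp]
      have := pow_apply_backward_orbit hu m 0
      rw [add_zero] at this
      rw [this]
    rw [heq]
    refine h2 _ fun k hk => ?_
    obtain ⟨m, hm, rfl⟩ := Finset.mem_image.1 hk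
    have := hlt m hm
    rcases hF m (Finset.mem_filter.1 hm).1 this.ne with h | h <;> omega
  · have hgt : ∀ m ∈ F.filter (fun m => ¬m < n), n < m := fun m hm => by
      obtain ⟨h, h'⟩ := Finset.mem_filter.1 hm
      have : m ≠ n := fun hmn => hn (hmn ▸ h)
      omega
    have hinj : Set.InjOn (fun m => m - n) (F.filter (fun m => ¬m < n) : Set ℕ) := by
      intro a ha b hb hab
      have := hgt a ha
      have := hgt b hb
      have : a - n = b - n := hab
      omega
    have heq : ∑ m ∈ F.filter (fun m => ¬m < n), (T ^ n) (u m) =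
        ∑ m ∈ (F.filter (fun m => ¬m < n)).image (fun m => m - n), u m := by
      rw [Finset.sum_image hinj]
      refine Finset.sum_congr rfl fun m hm => ?_
      have h : m = n + (m - n) := by
        have := hgt m hm
        omega
      conv_lhs => rw [h]
      exact pow_apply_backward_orbit hu n (m - n)
    rw [heq]
    refine h1 _ fun k hk => ?_
    obtain ⟨m, hm, rfl⟩ := Finset.mem_image.1 hk
    have := hgt m hm
    rcases hF m (Finset.mem_filter.1 hm).1 this.ne' with h | h <;> omega

/-- The vector is the sum over `j` and over `m ∈ A j` of `u j m`. At a time `n ∈ A l` the term `j =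
l`, `m = n` returns `u l 0`; all others are small because the sets are far apart. -/
theorem exists_frequently_visiting_vector [CompleteSpace X] (T : X →L[ℂ] X) (u : ℕ → ℕ → X)
    (hu : ∀ j n, T (u j (n + 1)) = u j n) (hus : ∀ j, Summable (u j))
    (hTs : ∀ j, Summable fun n => (T ^ n) (u j 0)) :
    ∃ x : X, ∃ A : ℕ → Set ℕ, (∀ l, 0 < lowerDensity (A l)) ∧
      ∀ l, ∀ n ∈ A l, ‖(T ^ n) x - u l 0‖ ≤ 4 * (1 / 2 : ℝ) ^ l := by
  -- A single threshold serves the orbits `0, ..., k` at once. Points of `A j` and `A l` are at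
  -- least `N (max j l)` apart, so the tails of `u j` seen from `A l` are at most `(1 / 4) ^ max j
  -- l`.
  have hN : ∀ k, ∃ N, ∀ i ≤ k, ∀ F : Finset ℕ, (∀ m ∈ F, N ≤ m) →
      ‖∑ m ∈ F, u i m‖ ≤ (1 / 4 : ℝ) ^ k ∧ ‖∑ m ∈ F, (T ^ m) (u i 0)‖ ≤ (1 / 4 : ℝ) ^ k := by
    intro k
    have hε : (0 : ℝ) < (1 / 4) ^ k := by positivity
    choose N₁ hN₁ using fun i => exists_tail_bound (hus i) hε
    choose N₂ hN₂ using fun i => exists_tail_bound (hTs i) hε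
    refine ⟨(Finset.range (k + 1)).sup fun i => max (N₁ i) (N₂ i), fun i hi F hF => ?_⟩
    have h : max (N₁ i) (N₂ i) ≤ (Finset.range (k + 1)).sup fun i => max (N₁ i) (N₂ i) :=
      Finset.le_sup (f := fun i => max (N₁ i) (N₂ i)) (Finset.mem_range.2 (by omega))
    exact ⟨hN₁ i F fun m hm => (le_max_left _ _).trans (h.trans (hF m hm)),
      hN₂ i F fun m hm => (le_max_right _ _).trans (h.trans (hF m hm))⟩
  choose N hN using hN
  obtain ⟨A, hA, hAN, hAd, hAs⟩ := exists_separated_sets N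
  let v : ℕ → X := fun j => ∑' m, (A j).indicator (u j) m
  have hvs : ∀ j, HasSum ((A j).indicator (u j)) (v j) := fun j => ((hus j).indicator _).hasSum
  have hv : ∀ j, ‖v j‖ ≤ (1 / 4 : ℝ) ^ j := by
    intro j
    refine le_of_tendsto (hvs j).norm (Eventually.of_forall fun F => ?_)
    classical
    rw [Finset.sum_indicator_eq_sum_filter]
    exact (hN j j le_rfl _ fun m hm => hAN j m (Finset.mem_filter.1 hm).2).1
  have hvsum : Summable v :=
    Summable.of_norm_bounded (summable_geometric_of_lt_one (by norm_num) (by norm_num)) hv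
  refine ⟨∑' j, v j, A, hA, fun l n hn => ?_⟩
  have hterm : ∀ j, ‖(T ^ n) (v j) - (if j = l then u l 0 else 0)‖ ≤
      2 * (1 / 4 : ℝ) ^ max j l := by
    intro j
    have hsum : HasSum (fun m => (T ^ n) ((A j).indicator (u j) m) -
        (if m = n then (if j = l then u l 0 else 0) else 0))
        ((T ^ n) (v j) - (if j = l then u l 0 else 0)) :=
      (((T ^ n).hasSum (hvs j))).sub (hasSum_ite_eq n _)
    refine le_of_tendsto hsum.norm (Eventually.of_forall fun F => ?_)
    classical
    have heq : ∑ m ∈ F, ((T ^ n) ((A j).indicator (u j) m) -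
        (if m = n then (if j = l then u l 0 else 0) else 0)) =
        ∑ m ∈ F.filter (fun m => m ∈ A j ∧ m ≠ n), (T ^ n) (u j m) := by
      rw [Finset.sum_filter]
      refine Finset.sum_congr rfl fun m _ => ?_
      by_cases hmn : m = n
      · subst hmn
        by_cases hjl : j = l
        · subst hjl
          have := pow_apply_backward_orbit (hu j) m 0
          rw [add_zero] at this
          simp [hn, this]
        · have : m ∉ A j := fun h => hjl (hAd j l m h hn)
          simp [this, hjl]
      · by_cases hm : m ∈ A j <;> simp [hm, hmn]
    rw [heq]
    refine norm_sum_pow_backward_orbit_le (hu j) (N := N (max j l))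
      (fun F hF => (hN _ j (le_max_left _ _) F hF).1)
      (fun F hF => (hN _ j (le_max_left _ _) F hF).2) n _ (fun m hm hmn => ?_) (by simp)
    have hmA := (Finset.mem_filter.1 hm).2.1
    rcases lt_or_gt_of_ne hmn with h | h
    · left
      obtain ⟨h1, h2⟩ := hAs j l m n hmA hn h
      rcases max_choice j l with h' | h' <;> rw [h'] <;> assumption
    · right
      obtain ⟨h1, h2⟩ := hAs l j n m hn hmA h
      rcases max_choice j l with h' | h' <;> rw [h'] <;> assumption
  have hsum : HasSum (fun j => (T ^ n) (v j) - (if j = l then u l 0 else 0))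
      ((T ^ n) (∑' j, v j) - u l 0) :=
    ((T ^ n).hasSum hvsum.hasSum).sub (hasSum_ite_eq l _)
  -- The bound `(1 / 4) ^ max j l ≤ (1 / 2) ^ l * (1 / 2) ^ j` is summable in `j` and still small in
  -- `l`.
  have hgeo : HasSum (fun j : ℕ => 2 * (1 / 2 : ℝ) ^ l * (1 / 2 : ℝ) ^ j)
      (2 * (1 / 2 : ℝ) ^ l * 2) := hasSum_geometric_two.mul_left _
  have hle := hsum.norm_le_of_bounded hgeo fun j => (hterm j).trans ?_
  · linarith
  · have h1 : (1 / 4 : ℝ) ^ max j l = (1 / 2) ^ max j l * (1 / 2) ^ max j l := by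
      rw [← mul_pow]
      norm_num
    rw [h1, mul_assoc]
    refine mul_le_mul_of_nonneg_left (mul_le_mul
      (pow_le_pow_of_le_one (by norm_num) (by norm_num) (le_max_right _ _))
      (pow_le_pow_of_le_one (by norm_num) (by norm_num) (le_max_left _ _))
      (by positivity) (by positivity)) (by norm_num)

/-- The vectors with a summable forward orbit and a summable backward orbit. -/
def summableOrbits (T : X →L[ℂ] X) : Submodule ℂ X where
  carrier := {y | (Summable fun n => (T ^ n) y) ∧
    ∃ u : ℕ → X, u 0 = y ∧ (∀ n, T (u (n + 1)) = u n) ∧ Summable u}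
  add_mem' := by
    rintro y z ⟨hy, u, rfl, hu, hus⟩ ⟨hz, v, rfl, hv, hvs⟩
    exact ⟨by simpa using hy.add hz, u + v, rfl, fun n => by simp [hu, hv], hus.add hvs⟩
  zero_mem' := ⟨by simp, 0, rfl, fun n => by simp, summable_zero⟩
  smul_mem' := by
    rintro c y ⟨hy, u, rfl, hu, hus⟩
    exact ⟨by simpa using hy.const_smul c, c • u, rfl, fun n => by simp [hu], hus.const_smul c⟩

theorem mem_summableOrbits {T : X →L[ℂ] X} {u : ℕ → X} (h0 : Summable fun n => (T ^ n) (u 0))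
    (hu : ∀ n, T (u (n + 1)) = u n) (hus : Summable u) (n : ℕ) : u n ∈ summableOrbits T := by
  refine ⟨(summable_nat_add_iff n).1 ?_, fun k => u (k + n), by simp, fun k => ?_,
    (summable_nat_add_iff n).2 hus⟩
  · refine h0.congr fun k => ?_
    have := pow_apply_backward_orbit hu n 0
    rw [add_zero] at this
    rw [pow_add, mul_apply_eq_comp, this]
  · change T (u (k + 1 + n)) = u (k + n)
    rw [← hu (k + n), add_right_comm]

theorem pow_apply_mem_summableOrbits {T : X →L[ℂ] X} {y : X} (hy : y ∈ summableOrbits T) (n : ℕ) :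
    (T ^ n) y ∈ summableOrbits T := by
  obtain ⟨hy, u, rfl, hu, hus⟩ := hy
  refine ⟨((summable_nat_add_iff n).2 hy).congr fun k => ?_,
    fun k => (T ^ n) (u k), rfl, fun k => ?_, (T ^ n).summable hus⟩
  · rw [pow_add, mul_apply_eq_comp]
  · rw [← mul_apply_eq_comp, ← pow_succ', pow_succ, mul_apply_eq_comp, hu]

theorem isFrequentlySupercyclic_of_dense_summableOrbits [CompleteSpace X]
    [TopologicalSpace.SeparableSpace X] {T : X →L[ℂ] X} (hT : Dense (summableOrbits T : Set X))
    {Γ : Set ℂ} (hΓ : (Γ \ {0}).Nonempty) : IsFrequentlySupercyclic Γ T := by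
  have : SecondCountableTopology X := UniformSpace.secondCountable_of_separable X
  obtain ⟨t, htM, htc, htd⟩ := hT.exists_countable_dense_subset
  have htne : t.Nonempty := htd.nonempty
  obtain ⟨y, rfl⟩ := htc.exists_eq_range htne
  have hy : ∀ j, y j ∈ summableOrbits T := fun j => htM ⟨j, rfl⟩
  choose hyT u hu0 hu hus using hy
  obtain ⟨x, A, hA, hx⟩ := exists_frequently_visiting_vector T (fun j => u (Nat.unpair j).1)
    (fun j => hu _) (fun j => hus _) (fun j => by
      rw [hu0]
      exact hyT _)
  obtain ⟨γ, hγ, hγ0⟩ := hΓ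
  have hγ0 : γ ≠ 0 := hγ0
  refine ⟨γ⁻¹ • x, fun U hU hUne => ?_⟩
  obtain ⟨_, hyU, i, rfl⟩ := htd.inter_open_nonempty U hU hUne
  obtain ⟨ε, hε, hball⟩ := Metric.isOpen_iff.1 hU _ hyU
  obtain ⟨k, hk⟩ := exists_pow_lt_of_lt_one (show 0 < ε / 4 by positivity)
    (show (1 / 2 : ℝ) < 1 by norm_num)
  refine lt_of_lt_of_le (hA (Nat.pair i k)) (lowerDensity_mono fun n hn => ⟨γ, hγ, hball ?_⟩)
  rw [smul_inv_smul₀ hγ0, mem_ball_iff_norm]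
  have h := hx _ n hn
  rw [Nat.unpair_pair, hu0] at h
  refine h.trans_lt ?_
  have h2 : (1 / 2 : ℝ) ^ Nat.pair i k ≤ (1 / 2) ^ k :=
    pow_le_pow_of_le_one (by norm_num) (by norm_num) (Nat.right_le_pair i k)
  linarith

end Criterion

/-! ### Weighted shifts on `ℓ_p` -/

theorem exists_weight_bound {ι : Type*} {w : ι → ℝ} (hw : Bornology.IsBounded (Set.range w)) : ∃ W : ℝ, ∀ k, w k ≤ W := by
  obtain ⟨W, hW⟩ := hw.exists_norm_le
  exact ⟨W, fun k => (le_abs_self _).trans (hW _ ⟨k, rfl⟩)⟩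

theorem lp_single_mem_of_smul {ι : Type*} {p : ℝ≥0∞} [DecidableEq ι] {M : Submodule ℂ (lp (fun _ : ι => ℂ) p)} {k : ι}
    {a : ℂ} (ha : a ≠ 0) (h : lp.single p k a ∈ M) : lp.single p k (1 : ℂ) ∈ M := by
  have : (lp.single p k (1 : ℂ) : lp (fun _ : ι => ℂ) p) = a⁻¹ • lp.single p k a := by
    rw [← lp.single_smul, smul_eq_mul, inv_mul_cancel₀ ha]
  rw [this]
  exact M.smul_mem _ h

section Lp

variable {ι : Type*} {p : ℝ≥0∞} [Fact (1 ≤ p)]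

theorem toReal_pos_of_one_le (hp : p ≠ ∞) : 0 < p.toReal :=
  ENNReal.toReal_pos (zero_lt_one.trans_le (Fact.out : 1 ≤ p)).ne' hp

/-- The terms are the coordinates of one `ℓ_p` vector supported on the range of `e`, so its
unit-vector expansion restricts to this series. -/
theorem summable_lp_single [DecidableEq ι] (hp : p ≠ ∞) {e : ℕ → ι} (he : Function.Injective e)
    {a : ℕ → ℂ} (ha : Summable fun n => ‖a n‖ ^ p.toReal) :
    Summable fun n => (lp.single p (e n) (a n) : lp (fun _ : ι => ℂ) p) := by
  have hp0 := toReal_pos_of_one_le hp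
  have hf : Memℓp (Function.extend e a 0 : ι → ℂ) p := by
    refine memℓp_gen ((he.summable_iff fun k hk => ?_).1 (ha.congr fun n => ?_))
    · rw [Function.extend_apply' _ _ _ hk]
      simp [hp0.ne']
    · simp [he.extend_apply]
  have h := (lp.hasSum_single hp ⟨_, hf⟩).summable.comp_injective he
  refine h.congr fun n => ?_
  simp [he.extend_apply]

theorem dense_of_lp_single_mem [DecidableEq ι] (hp : p ≠ ∞)
    {M : Submodule ℂ (lp (fun _ : ι => ℂ) p)} (hM : ∀ k, lp.single p k (1 : ℂ) ∈ M) :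
    Dense (M : Set (lp (fun _ : ι => ℂ) p)) := by
  intro x
  refine mem_closure_of_tendsto (lp.hasSum_single hp x) (Eventually.of_forall fun F => ?_)
  refine M.sum_mem fun k _ => ?_
  have : (lp.single p k (x k) : lp (fun _ : ι => ℂ) p) = x k • lp.single p k (1 : ℂ) := by
    rw [← lp.single_smul, smul_eq_mul, mul_one]
  rw [this]
  exact M.smul_mem _ (hM k)

theorem separableSpace_lp [Countable ι] (hp : p ≠ ∞) :
    TopologicalSpace.SeparableSpace (lp (fun _ : ι => ℂ) p) := by
  classical
  let S : Set (lp (fun _ : ι => ℂ) p) := Set.range fun k => lp.single p k (1 : ℂ)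
  have hS : TopologicalSpace.IsSeparable (Submodule.span ℂ S : Set (lp (fun _ : ι => ℂ) p)) :=
    (Set.countable_range _).isSeparable.span
  have hd : Dense (Submodule.span ℂ S : Set (lp (fun _ : ι => ℂ) p)) :=
    dense_of_lp_single_mem hp fun k => Submodule.subset_span ⟨k, rfl⟩
  rw [← TopologicalSpace.isSeparable_univ_iff, ← hd.closure_eq]
  exact hS.closure

theorem sum_norm_rpow_le [DecidableEq ι] (hp : p ≠ ∞) {e : ℕ → ι} (he : Function.Injective e)
    (z : lp (fun _ : ι => ℂ) p) (F : Finset ℕ) :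
    ∑ d ∈ F, ‖z (e d)‖ ^ p.toReal ≤ ‖z‖ ^ p.toReal := by
  rw [← Finset.sum_image (f := fun k => ‖z k‖ ^ p.toReal) he.injOn]
  exact lp.sum_rpow_le_norm_rpow (toReal_pos_of_one_le hp) z _

/-- At the return times to a small ball around a unit vector the orbit is bounded, and its
coordinate there is bounded away from zero. -/
theorem exists_return_bounds {Γ : Set ℂ} (hΓ : Bornology.IsBounded (Γ \ {0}))
    (hΓ_away : ∃ ε : ℝ, 0 < ε ∧ ∀ γ ∈ Γ \ {0}, ε ≤ ‖γ‖) [DecidableEq ι]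
    (T : lp (fun _ : ι => ℂ) p →L[ℂ] lp (fun _ : ι => ℂ) p) (x : lp (fun _ : ι => ℂ) p) (k : ι) :
    ∃ c : ℝ, 0 < c ∧ ∃ C : ℝ, ∀ n ∈ returnSet T Γ x (Metric.ball (lp.single p k (1 : ℂ)) (1 / 2)),
      c ≤ ‖(T ^ n) x k‖ ∧ ‖(T ^ n) x‖ ≤ C := by
  obtain ⟨ε, hε, hεΓ⟩ := hΓ_away
  obtain ⟨M, hM0, hM⟩ := hΓ.exists_pos_norm_le
  have hp0 : p ≠ 0 := (zero_lt_one.trans_le (Fact.out : 1 ≤ p)).ne'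
  have he : ‖(lp.single p k (1 : ℂ) : lp (fun _ : ι => ℂ) p)‖ = 1 := by
    rw [lp.norm_single (zero_lt_one.trans_le (Fact.out : 1 ≤ p)), norm_one]
  refine ⟨1 / (2 * M), by positivity, 3 / 2 / ε, ?_⟩
  rintro n ⟨γ, hγ, hn⟩
  rw [mem_ball_iff_norm, map_smul] at hn
  -- For `γ = 0` the image is `0`, at distance `1` from the unit vector and thus outside the ball.
  have hγ0 : γ ≠ 0 := by
    rintro rfl
    rw [zero_smul, zero_sub, norm_neg, he] at hn
    norm_num at hn
  have hγ' : γ ∈ Γ \ {0} := ⟨hγ, hγ0⟩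
  constructor
  · have h1 : ‖γ * (T ^ n) x k - 1‖ < 1 / 2 := by
      have h2 := lp.norm_apply_le_norm (E := fun _ : ι => ℂ) hp0
        (γ • (T ^ n) x - lp.single p k (1 : ℂ)) k
      rw [lp.coeFn_sub, Pi.sub_apply, lp.coeFn_smul, Pi.smul_apply, smul_eq_mul,
        lp.single_apply_self] at h2
      exact h2.trans_lt hn
    rw [norm_sub_rev] at h1
    have h3 : 1 / 2 ≤ ‖γ * (T ^ n) x k‖ := by
      have := norm_sub_norm_le (1 : ℂ) (γ * (T ^ n) x k)
      rw [norm_one] at this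
      linarith
    rw [norm_mul] at h3
    have h4 : ‖γ‖ * ‖(T ^ n) x k‖ ≤ M * ‖(T ^ n) x k‖ :=
      mul_le_mul_of_nonneg_right (hM γ hγ') (norm_nonneg _)
    rw [div_le_iff₀ (by positivity)]
    linarith
  · have h1 : ‖γ • (T ^ n) x‖ ≤ 3 / 2 := by
      have := norm_sub_norm_le (γ • (T ^ n) x) (lp.single p k (1 : ℂ))
      rw [he] at this
      linarith
    rw [norm_smul] at h1
    rw [le_div_iff₀ hε, mul_comm]
    exact (mul_le_mul_of_nonneg_right (hεΓ γ hγ') (norm_nonneg _)).trans h1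

end Lp

section WeightedShift

variable {ι : Type*} [Add ι] [One ι] [IsRightCancelAdd ι] {p : ℝ≥0∞} [Fact (1 ≤ p)]
  {hp : p ≠ ∞} {w : ι → ℝ} {hw : Bornology.IsBounded (Set.range w)}

theorem weightedBackwardShift_single [DecidableEq ι] (k : ι) (a : ℂ) :
    weightedBackwardShift p hp w hw (lp.single p (k + 1) a) = lp.single p k (w k * a) := by
  ext l
  rw [weightedBackwardShift_apply]
  by_cases h : l = k
  · subst h
    rw [lp.single_apply_self, lp.single_apply_self]
  · have h' : l + 1 ≠ k + 1 := fun h' => h (add_right_cancel h')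
    rw [lp.single_apply_ne _ _ _ h, lp.single_apply_ne _ _ _ h', mul_zero]

/-- Sequences `j` step to the left and sequences `i` to the right; speaking of them instead of
indices lets `ℕ+` and `ℤ` share the proofs. -/
theorem weightedBackwardShift_pow_apply {j : ℕ → ι} (hj : ∀ n, j (n + 1) + 1 = j n)
    (y : lp (fun _ : ι => ℂ) p) (d : ℕ) :
    (weightedBackwardShift p hp w hw ^ d) y (j d) =
      ((∏ m ∈ Finset.range d, w (j (m + 1)) : ℝ) : ℂ) * y (j 0) := by
  induction d with
  | zero => simp
  | succ d ih =>
    rw [pow_succ', mul_apply_eq_comp, weightedBackwardShift_apply, hj, ih,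
      Finset.prod_range_succ, Complex.ofReal_mul]
    ring

theorem weightedBackwardShift_pow_apply_zero {i : ℕ → ι} (hi : ∀ n, i (n + 1) = i n + 1) (d : ℕ)
    (y : lp (fun _ : ι => ℂ) p) :
    (weightedBackwardShift p hp w hw ^ d) y (i 0) =
      ((∏ m ∈ Finset.range d, w (i m) : ℝ) : ℂ) * y (i d) := by
  induction d generalizing y with
  | zero => simp
  | succ d ih =>
    rw [pow_succ, mul_apply_eq_comp, ih, weightedBackwardShift_apply, ← hi,
      Finset.prod_range_succ, Complex.ofReal_mul]
    ring

theorem weightedBackwardShift_pow_single [DecidableEq ι] {j : ℕ → ι}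
    (hj : ∀ n, j (n + 1) + 1 = j n) (d : ℕ) :
    (weightedBackwardShift p hp w hw ^ d) (lp.single p (j 0) (1 : ℂ)) =
      lp.single p (j d) ((∏ m ∈ Finset.range d, w (j (m + 1)) : ℝ) : ℂ) := by
  induction d with
  | zero => simp
  | succ d ih =>
    rw [pow_succ', mul_apply_eq_comp, ih, ← hj d, weightedBackwardShift_single,
      Finset.prod_range_succ, Complex.ofReal_mul, mul_comm]

/-- If `n` and `n + d` are return times, the coordinate of `T ^ n x` at `i d` is at least `c / ∏ w`
in modulus. Since `‖T ^ n x‖ ≤ C`, the sum over these `d` is at most `C ^ p / c ^ p`, and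
boundedness of `w` gives the geometric control. -/
theorem summable_inv_prod_of_reiterative {Γ : Set ℂ} (hΓ : Bornology.IsBounded (Γ \ {0}))
    (hΓ_away : ∃ ε : ℝ, 0 < ε ∧ ∀ γ ∈ Γ \ {0}, ε ≤ ‖γ‖) (hw0 : ∀ k, 0 < w k)
    (hT : IsReiterativelySupercyclic Γ (weightedBackwardShift p hp w hw))
    {i : ℕ → ι} (hi : ∀ n, i (n + 1) = i n + 1) (hinj : Function.Injective i) :
    Summable fun n => (1 / ∏ m ∈ Finset.range n, w (i m)) ^ p.toReal := by
  classical
  have hp0 := toReal_pos_of_one_le hp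
  obtain ⟨x, hx⟩ := hT
  obtain ⟨c, hc, C, hcC⟩ := exists_return_bounds hΓ hΓ_away (weightedBackwardShift p hp w hw) x (i 0)
  have hE := hx _ Metric.isOpen_ball ⟨lp.single p (i 0) (1 : ℂ), Metric.mem_ball_self one_half_pos⟩
  set E := returnSet (weightedBackwardShift p hp w hw) Γ x
    (Metric.ball (lp.single p (i 0) (1 : ℂ)) (1 / 2))
  obtain ⟨W, hW⟩ := exists_weight_bound hw
  have hP : ∀ d, 0 < ∏ m ∈ Finset.range d, w (i m) := fun d => Finset.prod_pos fun m _ => hw0 _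
  have hW0 : 0 ≤ W := (hw0 (i 0)).le.trans (hW _)
  refine summable_of_sum_differences_le hE (fun d => by have := hP d; positivity)
    (R := W ^ p.toReal) (Or.inl fun d => ?_) (C := C ^ p.toReal / c ^ p.toReal)
    (Or.inl fun n hn N => ?_)
  · rw [← Real.mul_rpow hW0 (by have := hP (d + 1); positivity)]
    refine Real.rpow_le_rpow (by have := hP d; positivity) ?_ hp0.le
    rw [Finset.prod_range_succ, ← div_eq_mul_one_div, div_le_div_iff₀ (hP d)
      (mul_pos (hP d) (hw0 _)), one_mul, mul_comm]
    exact mul_le_mul_of_nonneg_right (hW _) (hP d).le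
  · rw [le_div_iff₀ (by positivity), Finset.sum_mul]
    refine (Finset.sum_le_sum fun d _ => ?_).trans ((sum_norm_rpow_le hp hinj
      ((weightedBackwardShift p hp w hw ^ n) x) (Finset.range N)).trans
      (Real.rpow_le_rpow (norm_nonneg _) (hcC n hn).2 hp0.le))
    by_cases hd : n + d ∈ E
    · rw [Set.indicator_of_mem (by exact hd), ← Real.mul_rpow (by have := hP d; positivity) hc.le]
      refine Real.rpow_le_rpow (by have := hP d; positivity) ?_ hp0.le
      have h := (hcC _ hd).1
      rw [add_comm, pow_add, mul_apply_eq_comp, weightedBackwardShift_pow_apply_zero hi, norm_mul,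
        Complex.norm_real, Real.norm_of_nonneg (hP d).le] at h
      rwa [one_div_mul_eq_div, div_le_iff₀ (hP d), mul_comm]
    · rw [Set.indicator_of_notMem (by exact hd), zero_mul]
      positivity

/-- Here one looks back: if `n - d` and `n` are return times, the coordinate of `T ^ n x` at `j d`
is the product of `d` weights times a coordinate of modulus at least `c`. -/
theorem summable_prod_of_reiterative {Γ : Set ℂ} (hΓ : Bornology.IsBounded (Γ \ {0}))
    (hΓ_away : ∃ ε : ℝ, 0 < ε ∧ ∀ γ ∈ Γ \ {0}, ε ≤ ‖γ‖) (hw0 : ∀ k, 0 < w k)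
    (hT : IsReiterativelySupercyclic Γ (weightedBackwardShift p hp w hw))
    {j : ℕ → ι} (hj : ∀ n, j (n + 1) + 1 = j n) (hinj : Function.Injective j) :
    Summable fun n => (∏ m ∈ Finset.range n, w (j (m + 1))) ^ p.toReal := by
  classical
  have hp0 := toReal_pos_of_one_le hp
  obtain ⟨x, hx⟩ := hT
  obtain ⟨c, hc, C, hcC⟩ := exists_return_bounds hΓ hΓ_away (weightedBackwardShift p hp w hw) x (j 0)
  have hE := hx _ Metric.isOpen_ball ⟨lp.single p (j 0) (1 : ℂ), Metric.mem_ball_self one_half_pos⟩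
  set E := returnSet (weightedBackwardShift p hp w hw) Γ x
    (Metric.ball (lp.single p (j 0) (1 : ℂ)) (1 / 2))
  obtain ⟨W, hW⟩ := exists_weight_bound hw
  have hP : ∀ d, 0 < ∏ m ∈ Finset.range d, w (j (m + 1)) := fun d =>
    Finset.prod_pos fun m _ => hw0 _
  have hW0 : 0 ≤ W := (hw0 (j 0)).le.trans (hW _)
  refine summable_of_sum_differences_le hE (fun d => by have := hP d; positivity)
    (R := W ^ p.toReal) (Or.inr fun d => ?_) (C := C ^ p.toReal / c ^ p.toReal)
    (Or.inr fun n hn N => ?_)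
  · rw [← Real.mul_rpow hW0 (hP d).le]
    refine Real.rpow_le_rpow (hP _).le ?_ hp0.le
    rw [Finset.prod_range_succ, mul_comm]
    exact mul_le_mul_of_nonneg_right (hW _) (hP d).le
  · rw [le_div_iff₀ (by positivity), Finset.sum_mul]
    refine (Finset.sum_le_sum fun d _ => ?_).trans ((sum_norm_rpow_le hp hinj
      ((weightedBackwardShift p hp w hw ^ n) x) (Finset.range N)).trans
      (Real.rpow_le_rpow (norm_nonneg _) (hcC n hn).2 hp0.le))
    by_cases hd : d ≤ n ∧ n - d ∈ E
    · rw [Set.indicator_of_mem (by exact hd), ← Real.mul_rpow (hP d).le hc.le]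
      refine Real.rpow_le_rpow (by have := hP d; positivity) ?_ hp0.le
      have h := (hcC _ hd.2).1
      have hn' : n = d + (n - d) := by omega
      rw [hn', pow_add, mul_apply_eq_comp, weightedBackwardShift_pow_apply hj, norm_mul,
        Complex.norm_real, Real.norm_of_nonneg (hP d).le]
      exact mul_le_mul_of_nonneg_left h (hP d).le
    · rw [Set.indicator_of_notMem (by exact hd), zero_mul]
      positivity

/-- The unit vectors to the right of `i 0` have summable orbits. -/
theorem lp_single_mem_summableOrbits [DecidableEq ι] (hw0 : ∀ k, 0 < w k)
    {i : ℕ → ι} (hi : ∀ n, i (n + 1) = i n + 1) (hinj : Function.Injective i)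
    (hsum : Summable fun n => (1 / ∏ m ∈ Finset.range n, w (i m)) ^ p.toReal)
    (h0 : Summable fun n => (weightedBackwardShift p hp w hw ^ n) (lp.single p (i 0) (1 : ℂ)))
    (n : ℕ) : lp.single p (i n) (1 : ℂ) ∈ summableOrbits (weightedBackwardShift p hp w hw) := by
  have hP : ∀ d, 0 < ∏ m ∈ Finset.range d, w (i m) := fun d => Finset.prod_pos fun m _ => hw0 _
  -- This is the backward orbit of the unit vector at `i 0`; its `n`-th term is a non-zero multiple
  -- of the unit vector at `i n`.
  let u : ℕ → lp (fun _ : ι => ℂ) p := fun n =>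
    lp.single p (i n) ((1 / ∏ m ∈ Finset.range n, w (i m) : ℝ) : ℂ)
  have hu : ∀ n, weightedBackwardShift p hp w hw (u (n + 1)) = u n := by
    intro n
    simp only [u]
    rw [hi, weightedBackwardShift_single, ← Complex.ofReal_mul, Finset.prod_range_succ]
    congr 2
    have h1 := (hP n).ne'
    have h2 := (hw0 (i n)).ne'
    field_simp
  have hus : Summable u := by
    refine summable_lp_single hp hinj (hsum.congr fun n => ?_)
    have := hP n
    rw [Complex.norm_real, Real.norm_of_nonneg (by positivity)]
  refine lp_single_mem_of_smul ?_ (mem_summableOrbits ?_ hu hus n)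
  · have := hP n
    exact_mod_cast (by positivity : (1 / ∏ m ∈ Finset.range n, w (i m)) ≠ 0)
  · simpa [u] using h0

theorem isFrequentlySupercyclic_of_lp_single_mem [Countable ι] [DecidableEq ι] {Γ : Set ℂ}
    (hΓ : (Γ \ {0}).Nonempty)
    (h : ∀ k, lp.single p k (1 : ℂ) ∈ summableOrbits (weightedBackwardShift p hp w hw)) :
    IsFrequentlySupercyclic Γ (weightedBackwardShift p hp w hw) := by
  have := separableSpace_lp (ι := ι) hp
  exact isFrequentlySupercyclic_of_dense_summableOrbits (dense_of_lp_single_mem hp h) hΓ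

end WeightedShift

theorem IsFamilyHypercyclic.mono {X : Type*} [NormedAddCommGroup X] [NormedSpace ℂ X]
    {F G : Set (Set ℕ)} (hFG : F ⊆ G) {Γ : Set ℂ} {T : X →L[ℂ] X}
    (h : IsFamilyHypercyclic F Γ T) : IsFamilyHypercyclic G Γ T := by
  obtain ⟨x, hx⟩ := h
  exact ⟨x, fun U hU hne => hFG (hx U hU hne)⟩

theorem posLowerDensity_subset : posLowerDensity ⊆ posUpperDensity := fun E hE =>
  lt_of_lt_of_le hE (lowerDensity_le_upperDensity E)

theorem posUpperDensity_subset : posUpperDensity ⊆ posUpperBanachDensity := fun _ hE =>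
  upperBanachDensity_pos hE

/-! ### The unilateral shift -/

theorem prod_Icc_succPNat (w : ℕ+ → ℝ) (n : ℕ) :
    ∏ i ∈ Finset.Icc 1 (Nat.succPNat n), w i = ∏ m ∈ Finset.range (n + 1), w (Nat.succPNat m) := by
  have h : Finset.Icc 1 (Nat.succPNat n) = (Finset.range (n + 1)).image Nat.succPNat := by
    ext k
    simp only [Finset.mem_Icc, Finset.mem_image, Finset.mem_range]
    constructor
    · rintro ⟨-, hk⟩
      refine ⟨k.natPred, ?_, PNat.succPNat_natPred k⟩
      have h1 : (k : ℕ) ≤ n + 1 := hk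
      have h2 := k.natPred_add_one
      omega
    · rintro ⟨m, hm, rfl⟩
      exact ⟨one_le, Nat.succPNat_le_succPNat.2 (by omega)⟩
  rw [h, Finset.prod_image Nat.succPNat_injective.injOn]

/-- The sum over `ℕ` has one more term, the empty product at `n = 0`. The same holds for the two
bilateral counterparts. -/
theorem summable_unilateral_iff (w : ℕ+ → ℝ) (r : ℝ) :
    Summable (fun n : ℕ+ => (1 / ∏ i ∈ Finset.Icc 1 n, w i) ^ r) ↔
      Summable fun n : ℕ => (1 / ∏ m ∈ Finset.range n, w (Nat.succPNat m)) ^ r := by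
  rw [← summable_nat_add_iff 1, ← Equiv.pnatEquivNat.symm.summable_iff]
  refine summable_congr fun n => ?_
  rw [← prod_Icc_succPNat]
  rfl

/-- The first unit vector is killed by the shift, so no condition on the left is needed in the
unilateral case. -/
theorem summable_pow_single_one {p : ℝ≥0∞} [Fact (1 ≤ p)] {hp : p ≠ ∞} {w : ℕ+ → ℝ}
    {hw : Bornology.IsBounded (Set.range w)} :
    Summable fun n => (weightedBackwardShift p hp w hw ^ n) (lp.single p 1 (1 : ℂ)) := by
  have h : weightedBackwardShift p hp w hw (lp.single p 1 (1 : ℂ)) = 0 := by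
    ext l
    rw [weightedBackwardShift_apply, lp.single_apply_ne, mul_zero]
    · rfl
    · exact (PNat.lt_add_left 1 l).ne'
  refine (summable_nat_add_iff 1).1 (summable_zero.congr fun n => ?_)
  rw [pow_succ, mul_apply_eq_comp, h, map_zero]

/-! ### The bilateral shift -/

theorem prod_Icc_one_intCast (w : ℤ → ℝ) (n : ℕ) :
    ∏ i ∈ Finset.Icc 1 ((n : ℤ) + 1), w i = ∏ m ∈ Finset.range (n + 1), w ((m : ℤ) + 1) := by
  have h : Finset.Icc 1 ((n : ℤ) + 1) =
      (Finset.range (n + 1)).image fun m : ℕ => (m : ℤ) + 1 := by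
    ext k
    simp only [Finset.mem_Icc, Finset.mem_image, Finset.mem_range]
    constructor
    · rintro ⟨h1, h2⟩
      exact ⟨(k - 1).toNat, by omega, by omega⟩
    · rintro ⟨m, hm, rfl⟩
      omega
  rw [h, Finset.prod_image fun a _ b _ hab => by simpa using hab]

theorem prod_Icc_neg_one (w : ℤ → ℝ) (n : ℕ) :
    ∏ i ∈ Finset.Icc (-((n : ℤ) + 1)) (-1), w i =
      ∏ m ∈ Finset.range (n + 1), w (-((m + 1 : ℕ) : ℤ)) := by
  have h : Finset.Icc (-((n : ℤ) + 1)) (-1) =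
      (Finset.range (n + 1)).image fun m : ℕ => -((m + 1 : ℕ) : ℤ) := by
    ext k
    simp only [Finset.mem_Icc, Finset.mem_image, Finset.mem_range]
    constructor
    · rintro ⟨h1, h2⟩
      exact ⟨(-k - 1).toNat, by omega, by omega⟩
    · rintro ⟨m, hm, rfl⟩
      omega
  rw [h, Finset.prod_image fun a _ b _ hab => by simpa using hab]

/-- The positive integers, enumerated by `n ↦ n + 1`. -/
def natEquivPosInt : ℕ ≃ {n : ℤ // 1 ≤ n} where
  toFun n := ⟨(n : ℤ) + 1, by omega⟩
  invFun n := ((n : ℤ) - 1).toNat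
  left_inv n := by simp
  right_inv n := by
    have := n.2
    ext
    simp only
    omega

/-- The negative integers, enumerated by `n ↦ -(n + 1)`. -/
def natEquivNegInt : ℕ ≃ {n : ℤ // n < 0} where
  toFun n := ⟨-((n : ℤ) + 1), by omega⟩
  invFun n := (-(n : ℤ) - 1).toNat
  left_inv n := by simp
  right_inv n := by
    have := n.2
    ext
    simp only
    omega

theorem summable_positive_iff (w : ℤ → ℝ) (r : ℝ) :
    Summable (fun n : {n : ℤ // 1 ≤ n} => (1 / ∏ i ∈ Finset.Icc 1 (n : ℤ), w i) ^ r) ↔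
      Summable fun n : ℕ => (1 / ∏ m ∈ Finset.range n, w ((m : ℤ) + 1)) ^ r := by
  rw [← summable_nat_add_iff 1, ← natEquivPosInt.summable_iff]
  refine summable_congr fun n => ?_
  rw [← prod_Icc_one_intCast]
  rfl

theorem summable_negative_iff (w : ℤ → ℝ) (r : ℝ) :
    Summable (fun n : {n : ℤ // n < 0} => (∏ i ∈ Finset.Icc (n : ℤ) (-1), w i) ^ r) ↔
      Summable fun n : ℕ => (∏ m ∈ Finset.range n, w (-((m + 1 : ℕ) : ℤ))) ^ r := by
  rw [← summable_nat_add_iff 1, ← natEquivNegInt.summable_iff]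
  refine summable_congr fun n => ?_
  rw [← prod_Icc_neg_one]
  rfl

theorem lp_single_mem_summableOrbits_int {p : ℝ≥0∞} [Fact (1 ≤ p)] {hp : p ≠ ∞} {w : ℤ → ℝ}
    {hw : Bornology.IsBounded (Set.range w)} (hw0 : ∀ k, 0 < w k)
    (hpos : Summable fun n : ℕ => (1 / ∏ m ∈ Finset.range n, w ((m : ℤ) + 1)) ^ p.toReal)
    (hneg : Summable fun n : ℕ => (∏ m ∈ Finset.range n, w (-((m + 1 : ℕ) : ℤ))) ^ p.toReal)
    (k : ℤ) : lp.single p k (1 : ℂ) ∈ summableOrbits (weightedBackwardShift p hp w hw) := by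
  -- The base point is `1`, where the products `w 1 * w 2 * ⋯` start. Going left from there first
  -- meets `w 0`, a constant factor absent from `hneg`.
  let j : ℕ → ℤ := fun n => 1 - (n : ℤ)
  have hj : ∀ n, j (n + 1) + 1 = j n := fun n => by
    simp only [j]
    push_cast
    ring
  have hjinj : Function.Injective j := fun a b hab => by
    simp only [j] at hab
    omega
  have hP : ∀ d, 0 < ∏ m ∈ Finset.range d, w (j (m + 1)) := fun d =>
    Finset.prod_pos fun m _ => hw0 _
  have h0 : Summable fun n => (weightedBackwardShift p hp w hw ^ n) (lp.single p 1 (1 : ℂ)) := by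
    have h : ∀ n, (weightedBackwardShift p hp w hw ^ n) (lp.single p 1 (1 : ℂ)) =
        lp.single p (j n) ((∏ m ∈ Finset.range n, w (j (m + 1)) : ℝ) : ℂ) := fun n =>
      weightedBackwardShift_pow_single hj n
    simp only [h]
    refine summable_lp_single hp hjinj ((summable_nat_add_iff 1).1
      ((hneg.mul_left (w 0 ^ p.toReal)).congr fun n => ?_))
    rw [Complex.norm_real, Real.norm_of_nonneg (hP _).le, Finset.prod_range_succ',
      Real.mul_rpow (Finset.prod_nonneg fun m _ => (hw0 _).le) (hw0 _).le, mul_comm]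
    congr 2
  have hmem := lp_single_mem_summableOrbits (i := fun n : ℕ => (n : ℤ) + 1) hw0
    (fun n => by push_cast; ring) (fun a b hab => by simpa using hab) hpos
    (by simpa using h0)
  rcases le_or_gt 1 k with hk | hk
  · have := hmem (k - 1).toNat
    have hk' : (((k - 1).toNat : ℕ) : ℤ) + 1 = k := by omega
    rwa [hk'] at this
  -- For `k ≤ 0` the unit vector at `k` is, up to a non-zero factor, the image of the one at `1`
  -- under the power `1 - k`.
  · have h1 := hmem 0
    simp only [Nat.cast_zero, zero_add] at h1
    have h2 := pow_apply_mem_summableOrbits h1 (1 - k).toNat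
    have h3 := weightedBackwardShift_pow_single (hp := hp) (hw := hw) hj (1 - k).toNat
    have hk' : j (1 - k).toNat = k := by
      simp only [j]
      omega
    rw [hk'] at h3
    have hj0 : j 0 = 1 := by simp [j]
    rw [hj0] at h3
    rw [h3] at h2
    exact lp_single_mem_of_smul (by exact_mod_cast (hP _).ne') h2

end

theorem corollary5p10 (Γ : Set ℂ)
    (hΓ_nonempty : (Γ \ {0}).Nonempty)
    (hΓ_bounded : Bornology.IsBounded (Γ \ {0}))
    (hΓ_away : ∃ ε : ℝ, 0 < ε ∧ ∀ γ ∈ Γ \ {0}, ε ≤ ‖γ‖)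
    (p : ℝ≥0∞) [Fact (1 ≤ p)] (hp : p ≠ ∞) :
    (∀ (w : ℕ+ → ℝ) (hw : Bornology.IsBounded (Set.range w)), (∀ n, 0 < w n) →
      List.TFAE
        [ IsFrequentlySupercyclic Γ (weightedBackwardShift p hp w hw),
          IsUFrequentlySupercyclic Γ (weightedBackwardShift p hp w hw),
          IsReiterativelySupercyclic Γ (weightedBackwardShift p hp w hw),
          Summable (fun n : ℕ+ => (1 / ∏ i ∈ Finset.Icc 1 n, w i) ^ p.toReal) ]) ∧
    (∀ (w : ℤ → ℝ) (hw : Bornology.IsBounded (Set.range w)), (∀ n, 0 < w n) →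
      List.TFAE
        [ IsFrequentlySupercyclic Γ (weightedBackwardShift p hp w hw),
          IsUFrequentlySupercyclic Γ (weightedBackwardShift p hp w hw),
          IsReiterativelySupercyclic Γ (weightedBackwardShift p hp w hw),
          Summable (fun n : {n : ℤ // 1 ≤ n} =>
              (1 / ∏ i ∈ Finset.Icc 1 (n : ℤ), w i) ^ p.toReal) ∧
            Summable (fun n : {n : ℤ // n < 0} =>
              (∏ i ∈ Finset.Icc (n : ℤ) (-1), w i) ^ p.toReal) ]) := by
  constructor
  · intro w hw hw0
    tfae_have 1 → 2 := IsFamilyHypercyclic.mono posLowerDensity_subset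
    tfae_have 2 → 3 := IsFamilyHypercyclic.mono posUpperDensity_subset
    tfae_have 3 → 4 := fun h => (summable_unilateral_iff w _).2
      (summable_inv_prod_of_reiterative hΓ_bounded hΓ_away hw0 h (i := Nat.succPNat)
        (fun n => rfl) Nat.succPNat_injective)
    tfae_have 4 → 1 := fun h => by
      refine isFrequentlySupercyclic_of_lp_single_mem hΓ_nonempty fun k => ?_
      rw [← PNat.succPNat_natPred k]
      exact lp_single_mem_summableOrbits hw0 (i := Nat.succPNat) (fun n => rfl)
        Nat.succPNat_injective ((summable_unilateral_iff w _).1 h) summable_pow_single_one _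
    tfae_finish
  · intro w hw hw0
    tfae_have 1 → 2 := IsFamilyHypercyclic.mono posLowerDensity_subset
    tfae_have 2 → 3 := IsFamilyHypercyclic.mono posUpperDensity_subset
    tfae_have 3 → 4 := fun h => ⟨(summable_positive_iff w _).2
      (summable_inv_prod_of_reiterative hΓ_bounded hΓ_away hw0 h
        (i := fun n : ℕ => (n : ℤ) + 1) (fun n => by push_cast; ring)
        (fun a b hab => by simpa using hab)),
      (summable_negative_iff w _).2
      (summable_prod_of_reiterative hΓ_bounded hΓ_away hw0 h (j := fun n : ℕ => -(n : ℤ))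
        (fun n => by push_cast; ring) (fun a b hab => by simpa using hab))⟩
    tfae_have 4 → 1 := fun h => isFrequentlySupercyclic_of_lp_single_mem hΓ_nonempty
      (lp_single_mem_summableOrbits_int hw0 ((summable_positive_iff w _).1 h.1)
        ((summable_negative_iff w _).1 h.2))
    tfae_finish
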